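/- **Setting.** Let $G$ be a connected reductive linear algebraic group over $\mathbb{R}$, i.e. a Zariski-connected subgroup $G(\mathbb{C}) \subset \mathrm{GL}_N(\mathbb{C})$ cut out by polynomial equations with real coefficients whose unipotent radical is trivial. Let $X$ be a finite-dimensional real vector space, identified with $\mathbb{R}^n$ (row vectors), and let $\rho : G \to \mathrm{GL}(X)$ be an algebraic representation over $\mathbb{R}$, acting on the right: $xg = x\rho(g)$. Assume that $(G,\rho,X)$ is a prehomogeneous vector space, i.e. $X_{\mathbb{C}}$ contains a Zariski open dense $G$-orbit $X^+$. Assume that $X^+$ is an essentially symmetric space: there are a point $x_0 \in X^+(\mathbb{R})$ with stabilizer $H$ in $G$, an algebraic $\mathbb{R}$-subgroup $H_0 \subset H$ of finite index (so that $H_0\backslash G \to H\backslash G \simeq X^+$ is a finite covering), and an involution $\theta$ of $G$ defined over $\mathbb{R}$, such that $(G^\theta)^\circ \subset H_0 \subset G^\theta$. A polynomial $\phi \in \mathbb{R}[X]\smallsetminus\{0\}$ is a relative invariant with eigencharacter $\omega \in X^*(G)$ if $\phi(xg) = \omega(g)\phi(x)$ for all $g \in G(\mathbb{C})$ and $x \in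 X_{\mathbb{C}}$. For $s > 0$, the bundle $\mathscr{L}^s$ of $s$-densities on $X^+(\mathbb{R})$ has as fibre at $x$ the space of functions $\delta: (T_x X)^n \to \mathbb{C}$ with $\delta(Tv_1,\ldots,Tv_n) = |\det T|^s\, \delta(v_1,\ldots,v_n)$ for every linear $T$; the group $G(\mathbb{R})$ acts on it through the differentials of $x \mapsto xg$. Every $\Omega \in \bigwedge^{\max} X^\vee$ gives the $s$-density $|\Omega|^s$. **Lemma.** 1. The $G(\mathbb{R})$-equivariant line bundle $\mathscr{L}^{1/2}$ of half-densities on $X^+(\mathbb{R})$ is trivializable: it is isomorphic, as a smooth equivariant line bundle, to the product bundle $X^+(\mathbb{R}) \times \mathbb{C}$ with trivial action on $\mathbb{C}$. 2. There exists a relative invariant $\phi \in \mathbb{R}[X]$ with eigencharacter $(\det\rho)^2$. 3. For every such $\phi$ and every $\Omega \in (\bigwedge^{\max} X^\vee) \smallsetminus \{0\}$, the polynomial $\phi$ has no zero on $X^+(\mathbb{R})$, and $|\phi|^{-1/4}|\Omega|^{1/2}$ is a smooth, $G(\mathbb{R})$-invariant, nowhere-vanishing section of $\mathscr{L}^{1/2}$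 over $X^+(\mathbb{R})$. 4. Consequently, the $G(\mathbb{R})$-equivariant line bundle $\mathscr{L}^{1}$ of densities on $X^+(\mathbb{R})$ is trivializable. -/

import Mathlib

open scoped ContDiff

namespace PVS

noncomputable section

/-! ### Linear algebraic groups over the real numbers

A linear algebraic group over `ℝ` is given by its group of complex points, a subgroup of `GL_N(ℂ)`
cut out by polynomial equations with real coefficients. -/

/-- The matrix entries of an invertible matrix, as a point of affine `N²`-space. -/
def entries {N : ℕ} {R : Type*} [CommRing R] (g : GL (Fin N) R) : Fin N × Fin N → R :=
  fun ij => g.val ij.1 ij.2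

/-- The Zariski topology on complex affine space. Its closed sets are the common zero loci of sets
of complex polynomials. -/
@[reducible]
def affineZariski (σ : Type*) : TopologicalSpace (σ → ℂ) :=
  TopologicalSpace.induced (MvPolynomial.pointToPoint (k := ℂ)) PrimeSpectrum.zariskiTopology

/-- The Zariski topology on `GL_N(ℂ)`. -/
@[reducible]
def glZariski (N : ℕ) : TopologicalSpace (GL (Fin N) ℂ) :=
  TopologicalSpace.induced entries (affineZariski (Fin N × Fin N))

/-- `H` is an algebraic subgroup of `GL_N` defined over `ℝ`: the zero locus in `GL_N(ℂ)` of an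
ideal of polynomials with real coefficients. -/
def IsRealAlgebraic {N : ℕ} (H : Subgroup (GL (Fin N) ℂ)) : Prop :=
  ∃ I : Ideal (MvPolynomial (Fin N × Fin N) ℝ),
    ∀ g : GL (Fin N) ℂ, g ∈ H ↔ entries g ∈ MvPolynomial.zeroLocus ℂ I

/-- `H` is connected as an algebraic group. -/
def IsConnectedGroup {N : ℕ} (H : Subgroup (GL (Fin N) ℂ)) : Prop :=
  @IsConnected _ (glZariski N) (H : Set (GL (Fin N) ℂ))

/-- The underlying set of the identity component `H°` of an algebraic group `H`. -/
def identityComponent {N : ℕ} (H : Subgroup (GL (Fin N) ℂ)) : Set (GL (Fin N) ℂ) :=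
  @connectedComponentIn _ (glZariski N) (H : Set (GL (Fin N) ℂ)) 1

/-- `G` is reductive: its unipotent radical is trivial, that is, every closed connected normal
subgroup consisting of unipotent matrices is trivial. -/
def IsReductive {N : ℕ} (G : Subgroup (GL (Fin N) ℂ)) : Prop :=
  ∀ U : Subgroup (GL (Fin N) ℂ), U ≤ G →
    @IsClosed _ (glZariski N) (U : Set (GL (Fin N) ℂ)) → IsConnectedGroup U →
    (U.subgroupOf G).Normal → (∀ u ∈ U, IsNilpotent (u.val - 1)) → U = ⊥

/-- `f : G(ℂ) → ℂ` is a regular function defined over `ℝ`: a real polynomial in the matrix entries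
divided by a power of the determinant. -/
def IsRealRegular {N : ℕ} (G : Subgroup (GL (Fin N) ℂ)) (f : G → ℂ) : Prop :=
  ∃ (p : MvPolynomial (Fin N × Fin N) ℝ) (k : ℕ),
    ∀ g : G, f g = MvPolynomial.aeval (entries g.val) p * ((g.val.val.det)⁻¹) ^ k

/-- A homomorphism `G → GL_n` of algebraic groups over `ℝ`. -/
def IsRealMorphism {N n : ℕ} {G : Subgroup (GL (Fin N) ℂ)} (ρ : G →* GL (Fin n) ℂ) : Prop :=
  ∀ i j : Fin n, IsRealRegular G fun g => (ρ g).val i j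

/-- An involution of the algebraic group `G`, defined over `ℝ`. -/
def IsRealInvolution {N : ℕ} {G : Subgroup (GL (Fin N) ℂ)} (θ : G →* G) : Prop :=
  IsRealMorphism (G.subtype.comp θ) ∧ ∀ g : G, θ (θ g) = g

/-- The subgroup `G^θ` of fixed points of `θ`. -/
def fixedSubgroup {N : ℕ} {G : Subgroup (GL (Fin N) ℂ)} (θ : G →* G) :
    Subgroup (GL (Fin N) ℂ) :=
  (θ.eqLocus (MonoidHom.id G)).map G.subtype

/-! ### Prehomogeneous vector spaces

The space is `X = ℝⁿ` with `X_ℂ = ℂⁿ`, consisting of row vectors, on which `G` acts from the right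
by `x g = x ρ(g)`. -/

/-- The inclusion `ℝⁿ ⊆ ℂⁿ`. -/
def toComplex {n : ℕ} (x : Fin n → ℝ) : Fin n → ℂ := fun i => (x i : ℂ)

/-- The orbit `x G(ℂ)` in `ℂⁿ`. -/
def orbit {N n : ℕ} {G : Subgroup (GL (Fin N) ℂ)} (ρ : G →* GL (Fin n) ℂ) (x : Fin n → ℂ) :
    Set (Fin n → ℂ) :=
  Set.range fun g : G => Matrix.vecMul x (ρ g).val

/-- The set of complex points of `X⁺`, i.e. the points whose orbit is Zariski open and dense.
As two dense open orbits meet, this is the open dense orbit if there is one. -/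
def openOrbit {N n : ℕ} {G : Subgroup (GL (Fin N) ℂ)} (ρ : G →* GL (Fin n) ℂ) :
    Set (Fin n → ℂ) :=
  {x | @IsOpen _ (affineZariski (Fin n)) (orbit ρ x) ∧
    @Dense _ (affineZariski (Fin n)) (orbit ρ x)}

/-- The set of real points of `X⁺`. -/
def realOpenOrbit {N n : ℕ} {G : Subgroup (GL (Fin N) ℂ)} (ρ : G →* GL (Fin n) ℂ) :
    Set (Fin n → ℝ) :=
  {x | toComplex x ∈ openOrbit ρ}

/-- `(G, ρ, X)` is a prehomogeneous vector space: there is an open dense orbit. -/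
def IsPrehomogeneous {N n : ℕ} {G : Subgroup (GL (Fin N) ℂ)} (ρ : G →* GL (Fin n) ℂ) : Prop :=
  (openOrbit ρ).Nonempty

/-- The stabilizer in `G` of a point of `ℂⁿ`. -/
def stabilizer {N n : ℕ} {G : Subgroup (GL (Fin N) ℂ)} (ρ : G →* GL (Fin n) ℂ)
    (x : Fin n → ℂ) : Subgroup (GL (Fin N) ℂ) :=
  Subgroup.map G.subtype
    { carrier := {g : G | Matrix.vecMul x (ρ g).val = x}
      one_mem' := by simp
      mul_mem' := by
        intro a b ha hb
        simp only [Set.mem_ofPred_eq] at ha hb ⊢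
        rw [map_mul, Units.val_mul, ← Matrix.vecMul_vecMul, ha, hb]
      inv_mem' := by
        intro a ha
        simp only [Set.mem_ofPred_eq] at ha ⊢
        conv_lhs => rw [← ha]
        rw [Matrix.vecMul_vecMul, ← Units.val_mul, ← map_mul, mul_inv_cancel, map_one,
          Units.val_one, Matrix.vecMul_one] }

/-- The open orbit `X⁺` is an essentially symmetric space. With the base point `x₀ ∈ X⁺(ℝ)` and
`H = Stab_G(x₀)`, so that `X⁺ = H \ G`, it has a finite equivariant étale covering
`H₀ \ G → H \ G` by a symmetric space, where `(G^θ)° ⊆ H₀ ⊆ G^θ` for an involution `θ` of `G`. -/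
def IsEssentiallySymmetric {N n : ℕ} {G : Subgroup (GL (Fin N) ℂ)} (ρ : G →* GL (Fin n) ℂ) :
    Prop :=
  ∃ x₀ ∈ realOpenOrbit ρ, ∃ H₀ : Subgroup (GL (Fin N) ℂ), IsRealAlgebraic H₀ ∧
    H₀ ≤ stabilizer ρ (toComplex x₀) ∧ H₀.relIndex (stabilizer ρ (toComplex x₀)) ≠ 0 ∧
    ∃ θ : G →* G, IsRealInvolution θ ∧
      identityComponent (fixedSubgroup θ) ⊆ H₀ ∧ H₀ ≤ fixedSubgroup θ

/-- The character `(det ρ)²` of `G`. -/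
def detSq {N n : ℕ} {G : Subgroup (GL (Fin N) ℂ)} (ρ : G →* GL (Fin n) ℂ) : G →* ℂˣ :=
  (Matrix.GeneralLinearGroup.det.comp ρ) ^ 2

/-- The polynomial `φ ∈ ℝ[X]` is a relative invariant with eigencharacter `χ ∈ X^*(G)`. -/
def IsRelativeInvariant {N n : ℕ} {G : Subgroup (GL (Fin N) ℂ)} (ρ : G →* GL (Fin n) ℂ)
    (φ : MvPolynomial (Fin n) ℝ) (χ : G →* ℂˣ) : Prop :=
  φ ≠ 0 ∧ IsRealRegular G (fun g => (χ g : ℂ)) ∧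
    ∀ (g : G) (x : Fin n → ℂ),
      MvPolynomial.aeval (Matrix.vecMul x (ρ g).val) φ = (χ g : ℂ) * MvPolynomial.aeval x φ

/-! ### The action of the real points -/

/-- The group `G(ℝ)`, as a subgroup of `GL_N(ℝ)`. -/
def realPoints {N : ℕ} (G : Subgroup (GL (Fin N) ℂ)) : Subgroup (GL (Fin N) ℝ) :=
  G.comap (Matrix.GeneralLinearGroup.map (algebraMap ℝ ℂ))

/-- The inclusion `G(ℝ) ⊆ G(ℂ)`. -/
def realToComplex {N : ℕ} {G : Subgroup (GL (Fin N) ℂ)} (g : realPoints G) : G :=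
  ⟨Matrix.GeneralLinearGroup.map (algebraMap ℝ ℂ) g.val, g.property⟩

/-- The right action `x ↦ x g = x ρ(g)` of `g ∈ G(ℝ)` on `X(ℝ) = ℝⁿ`. The matrix `ρ(g)` has real
entries, see `toComplex_realAct`. -/
def realAct {N n : ℕ} {G : Subgroup (GL (Fin N) ℂ)} (ρ : G →* GL (Fin n) ℂ) (g : realPoints G)
    (x : Fin n → ℝ) : Fin n → ℝ :=
  Matrix.vecMul x ((ρ (realToComplex g)).val.map Complex.re)

theorem ofReal_re_rep {N n : ℕ} {G : Subgroup (GL (Fin N) ℂ)} {ρ : G →* GL (Fin n) ℂ}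
    (hρ : IsRealMorphism ρ) (g : realPoints G) (i j : Fin n) :
    (((ρ (realToComplex g)).val i j).re : ℂ) = (ρ (realToComplex g)).val i j := by
  obtain ⟨p, k, hp⟩ := hρ i j
  have h := hp (realToComplex g)
  have h1 : entries (realToComplex g).val
      = fun ij => algebraMap ℝ ℂ (entries g.val ij) := by
    funext ij
    simp [entries, realToComplex, Matrix.GeneralLinearGroup.map]
  have h2 : (realToComplex g).val.val.det = algebraMap ℝ ℂ g.val.val.det := by
    simp only [realToComplex]
    exact (RingHom.map_det (algebraMap ℝ ℂ) g.val.val).symm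
  have h3 : MvPolynomial.aeval (entries (realToComplex g).val) p
      = algebraMap ℝ ℂ (MvPolynomial.aeval (entries g.val) p) := by
    rw [h1]
    exact MvPolynomial.aeval_algebraMap_apply ℂ (entries g.val) p
  simp only at h
  rw [h, h3, h2]
  simp only [Complex.coe_algebraMap, ← Complex.ofReal_inv, ← Complex.ofReal_pow,
    ← Complex.ofReal_mul, Complex.ofReal_re]

theorem toComplex_realAct {N n : ℕ} {G : Subgroup (GL (Fin N) ℂ)} {ρ : G →* GL (Fin n) ℂ}
    (hρ : IsRealMorphism ρ) (g : realPoints G) (x : Fin n → ℝ) :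
    toComplex (realAct ρ g x) = Matrix.vecMul (toComplex x) (ρ (realToComplex g)).val := by
  funext j
  simp only [toComplex, realAct, Matrix.vecMul, dotProduct, Matrix.map_apply]
  push_cast
  exact Finset.sum_congr rfl fun i _ => by rw [ofReal_re_rep hρ]

/-! ### Densities

For `U ⊆ ℝⁿ` open, all tangent spaces of `U` are `ℝⁿ`, and the bundle of `s`-densities on `U` has as
its fibre at every point the space of `s`-densities on the vector space `ℝⁿ`. Complex-valued
densities are used. -/

/-- The line of `s`-densities (`s > 0`) on the vector space `ℝⁿ`: the functions `δ` of `n` vectors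
such that `δ(T v₁, …, T vₙ) = |det T|^s δ(v₁, …, vₙ)` for all linear maps `T`. -/
def Density (n : ℕ) (s : ℝ) : Submodule ℂ ((Fin n → (Fin n → ℝ)) → ℂ) where
  carrier := {δ | ∀ (T : (Fin n → ℝ) →ₗ[ℝ] (Fin n → ℝ)) (v : Fin n → (Fin n → ℝ)),
    δ (fun i => T (v i)) = ((|LinearMap.det T| ^ s : ℝ) : ℂ) * δ v}
  zero_mem' := by intro T v; simp
  add_mem' := by
    intro a b ha hb T v
    simp only [Pi.add_apply, ha T v, hb T v, mul_add]
  smul_mem' := by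
    intro c a ha T v
    simp only [Pi.smul_apply, smul_eq_mul, ha T v]
    ring

/-- The pull-back of an `s`-density by a linear map, `(L^* δ)(v₁, …, vₙ) = δ(L v₁, …, L vₙ)`. -/
def Density.pullback {n : ℕ} {s : ℝ} (L : (Fin n → ℝ) →ₗ[ℝ] (Fin n → ℝ)) (δ : Density n s) :
    Density n s :=
  ⟨fun v => δ.val fun i => L (v i), by
    intro T v
    have h1 := δ.property (L ∘ₗ T) v
    have h2 := δ.property L v
    simp only [LinearMap.comp_apply, LinearMap.det_comp, abs_mul] at h1
    change δ.val (fun i => L (T (v i))) = _ * δ.val (fun i => L (v i))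
    rw [h1, h2, Real.mul_rpow (abs_nonneg _) (abs_nonneg _)]
    push_cast
    ring⟩

theorem alternating_comp {n : ℕ} (Ω : (Fin n → ℝ) [⋀^Fin n]→ₗ[ℝ] ℝ)
    (T : (Fin n → ℝ) →ₗ[ℝ] (Fin n → ℝ)) (v : Fin n → (Fin n → ℝ)) :
    Ω (fun i => T (v i)) = LinearMap.det T * Ω v := by
  have h := Ω.eq_smul_basis_det (Pi.basisFun ℝ (Fin n))
  rw [h]
  simp only [AlternatingMap.smul_apply, smul_eq_mul]
  have := Module.Basis.det_comp (Pi.basisFun ℝ (Fin n)) T v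
  simp only [Function.comp_def] at this
  rw [this]
  ring

/-- The `s`-density `|Ω|^s` attached to `Ω ∈ ⋀^max X^∨`. -/
def absPow {n : ℕ} (Ω : (Fin n → ℝ) [⋀^Fin n]→ₗ[ℝ] ℝ) (s : ℝ) : Density n s :=
  ⟨fun v => ((|Ω v| ^ s : ℝ) : ℂ), by
    intro T v
    change ((|Ω fun i => T (v i)| ^ s : ℝ) : ℂ) = _ * ((|Ω v| ^ s : ℝ) : ℂ)
    rw [alternating_comp, abs_mul, Real.mul_rpow (abs_nonneg _) (abs_nonneg _)]
    push_cast
    ring⟩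

/-- `σ` is, over the open set `U ⊆ ℝⁿ`, a smooth section of the bundle of `s`-densities: its
coefficients in the constant frames are smooth functions. -/
def IsSmoothSection {n : ℕ} {s : ℝ} (U : Set (Fin n → ℝ)) (σ : (Fin n → ℝ) → Density n s) : Prop :=
  ∀ v : Fin n → (Fin n → ℝ), ContDiffOn ℝ ∞ (fun x => (σ x).val v) U

/-- The isomorphism of fibres `δ ↦ (dR_g)^* δ` from `x g` to `x`, where `R_g(x) = x g`. This is the
equivariant structure of the bundle of `s`-densities (written as pull-back). -/
def pullbackAt {N n : ℕ} {G : Subgroup (GL (Fin N) ℂ)} (ρ : G →* GL (Fin n) ℂ) {s : ℝ}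
    (g : realPoints G) (x : Fin n → ℝ) (δ : Density n s) : Density n s :=
  Density.pullback (fderiv ℝ (realAct ρ g) x : (Fin n → ℝ) →L[ℝ] (Fin n → ℝ)).toLinearMap δ

/-- The section `σ` of the bundle of `s`-densities over `X⁺(ℝ)` is `G(ℝ)`-invariant. -/
def IsInvariantSection {N n : ℕ} {G : Subgroup (GL (Fin N) ℂ)} (ρ : G →* GL (Fin n) ℂ) {s : ℝ}
    (σ : (Fin n → ℝ) → Density n s) : Prop :=
  ∀ g : realPoints G, ∀ x ∈ realOpenOrbit ρ, pullbackAt ρ g x (σ (realAct ρ g x)) = σ x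

/-- The bundle of `s`-densities on `X⁺(ℝ)` is `G(ℝ)`-equivariantly trivializable: it is isomorphic,
as a smooth equivariant line bundle, to `X⁺(ℝ) × ℂ` with the trivial action on `ℂ`. Only the values
of the family `Θ` over `X⁺(ℝ)` matter. -/
def IsEquivariantlyTrivializable {N n : ℕ} {G : Subgroup (GL (Fin N) ℂ)}
    (ρ : G →* GL (Fin n) ℂ) (s : ℝ) : Prop :=
  ∃ Θ : (Fin n → ℝ) → (Density n s ≃ₗ[ℂ] ℂ),
    (∀ σ : (Fin n → ℝ) → Density n s, IsSmoothSection (realOpenOrbit ρ) σ →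
      ContDiffOn ℝ ∞ (fun x => Θ x (σ x)) (realOpenOrbit ρ)) ∧
    (∀ f : (Fin n → ℝ) → ℂ, ContDiffOn ℝ ∞ f (realOpenOrbit ρ) →
      IsSmoothSection (realOpenOrbit ρ) fun x => (Θ x).symm (f x)) ∧
    ∀ g : realPoints G, ∀ x ∈ realOpenOrbit ρ, ∀ δ : Density n s,
      Θ x (pullbackAt ρ g x δ) = Θ (realAct ρ g x) δ

/-- The section `|φ|^a |Ω|^s` of the bundle of `s`-densities. -/
def twistedSection {n : ℕ} (φ : MvPolynomial (Fin n) ℝ) (a : ℝ)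
    (Ω : (Fin n → ℝ) [⋀^Fin n]→ₗ[ℝ] ℝ) (s : ℝ) (x : Fin n → ℝ) : Density n s :=
  ((|MvPolynomial.eval x φ| ^ a : ℝ) : ℂ) • absPow Ω s

end

end PVS

open PVS

/-! Everything rests on one nonzero polynomial `φ` over `ℝ` with `φ(xg) = det ρ(g)² φ(x)`. It has no
zero on `X⁺(ℝ)`, because a zero would spread over a Zariski dense orbit. Pulling an `s`-density back
along `g` multiplies it by `|det ρ(g)|^s`, so `|φ|^(-s/2) |Ω|^s` is an invariant frame
(`isEquivariantlyTrivializable_of_isRelativeInvariant`); `s = 1/2` and `s = 1` are the cases needed.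

To construct `φ`, let `𝔤` be the Lie algebra of `G`, `T` the differential of `θ`, and `B(A, A') =
tr(A A') + tr(T A · T A')`. This symmetric form is invariant under `T` and under the adjoint action.
A point `x` defines `L_x : 𝔤 → X_ℂ`, `A ↦ x dρ(A)`. Pulling the inverse form on `𝔤*` back along the
transpose of `L_x` gives a quadratic form on the dual of `X_ℂ`, whose Gram matrix is `momentMatrix`.
Its determinant is a polynomial in `x`, and invariance of `B` gives it the eigencharacter `(det
ρ)²`.

The determinant is nonzero at `x₀`. If `ξ` lies in the kernel of the Gram matrix, let `A ∈ 𝔤`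
satisfy `B(A', A) = ⟨L A', ξ⟩` for all `A'`, with `L = L_{x₀}`. Then `L A = 0`, so `T A = A`.
Moreover `A` is orthogonal to `ker L = 𝔤^T`, hence `2 B(A', A) = B(A' + T A', A) = 0` for all `A'`.
Thus `A = 0`, and `ξ = 0` because `L` is onto. Taking a real or imaginary part makes the polynomial
real.

Three facts enter. First, `B` is nondegenerate (`sumTraceForm_nondegenerate`): its radical is an
ideal of nilpotent matrices by Chevalley's replica argument, and the unipotent group it generates is
trivial in a reductive group. Second, `L` is surjective (`map_infAction_eq_top`): otherwise the open
orbit would have too small a Hausdorff dimension. Third, `ker L = 𝔤^T` (`infAction_eq_zero_iff`),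
which is the symmetric space hypothesis on the level of Lie algebras. -/

namespace PVS

noncomputable section

open scoped Topology

/-! ### Polynomial functions of a matrix and Zariski closed sets -/

section Zariski

variable {ι : Type*}

/-- The value of a polynomial in the entries at a matrix. -/
def matEval (f : MvPolynomial (ι × ι) ℂ) (M : Matrix ι ι ℂ) : ℂ :=
  MvPolynomial.eval (fun ij => M ij.1 ij.2) f

@[simp] theorem matEval_C (c : ℂ) (M : Matrix ι ι ℂ) : matEval (MvPolynomial.C c) M = c := by
  simp [matEval]

@[simp] theorem matEval_X (ij : ι × ι) (M : Matrix ι ι ℂ) :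
    matEval (MvPolynomial.X ij) M = M ij.1 ij.2 := by
  simp [matEval]

@[simp] theorem matEval_add (f g : MvPolynomial (ι × ι) ℂ) (M : Matrix ι ι ℂ) :
    matEval (f + g) M = matEval f M + matEval g M := by
  simp [matEval]

@[simp] theorem matEval_sub (f g : MvPolynomial (ι × ι) ℂ) (M : Matrix ι ι ℂ) :
    matEval (f - g) M = matEval f M - matEval g M := by
  simp [matEval]

@[simp] theorem matEval_mul (f g : MvPolynomial (ι × ι) ℂ) (M : Matrix ι ι ℂ) :
    matEval (f * g) M = matEval f M * matEval g M := by
  simp [matEval]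

@[simp] theorem matEval_pow (f : MvPolynomial (ι × ι) ℂ) (k : ℕ) (M : Matrix ι ι ℂ) :
    matEval (f ^ k) M = matEval f M ^ k := by
  simp [matEval]

@[simp] theorem matEval_sum {κ : Type*} (s : Finset κ) (f : κ → MvPolynomial (ι × ι) ℂ)
    (M : Matrix ι ι ℂ) : matEval (∑ k ∈ s, f k) M = ∑ k ∈ s, matEval (f k) M := by
  simp [matEval]

/-- Substitution of polynomials for the entries. -/
theorem matEval_bind {κ : Type*} (f : MvPolynomial (ι × ι) ℂ)
    (F : Matrix ι ι (MvPolynomial (κ × κ) ℂ)) (M : Matrix κ κ ℂ) :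
    matEval (MvPolynomial.bind₁ (fun ij => F ij.1 ij.2) f) M
      = matEval f (F.map fun p => matEval p M) := by
  simp only [matEval, Matrix.map_apply]
  exact MvPolynomial.eval₂Hom_bind₁ _ _ _ _

theorem continuous_matEval (f : MvPolynomial (ι × ι) ℂ) : Continuous (matEval f) := by
  unfold matEval
  exact (MvPolynomial.continuous_eval f).comp (by fun_prop)

/-- Left translation of a polynomial function. -/
theorem exists_matEval_mul_left [Fintype ι] (f : MvPolynomial (ι × ι) ℂ) (g : Matrix ι ι ℂ) :
    ∃ f' : MvPolynomial (ι × ι) ℂ, ∀ M, matEval f' M = matEval f (g * M) := by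
  refine ⟨MvPolynomial.bind₁ (fun ij => (Matrix.of fun i j => ∑ k, MvPolynomial.C (g i k) *
    MvPolynomial.X (k, j) : Matrix ι ι (MvPolynomial (ι × ι) ℂ)) ij.1 ij.2) f, fun M => ?_⟩
  rw [matEval_bind]
  congr 1
  ext i j
  simp [Matrix.mul_apply]

/-- Right translation of a polynomial function. -/
theorem exists_matEval_mul_right [Fintype ι] (f : MvPolynomial (ι × ι) ℂ) (g : Matrix ι ι ℂ) :
    ∃ f' : MvPolynomial (ι × ι) ℂ, ∀ M, matEval f' M = matEval f (M * g) := by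
  refine ⟨MvPolynomial.bind₁ (fun ij => (Matrix.of fun i j => ∑ k, MvPolynomial.X (i, k) *
    MvPolynomial.C (g k j) : Matrix ι ι (MvPolynomial (ι × ι) ℂ)) ij.1 ij.2) f, fun M => ?_⟩
  rw [matEval_bind]
  congr 1
  ext i j
  simp [Matrix.mul_apply]

theorem isClosed_affineZariski_iff {σ : Type*} {Z : Set (σ → ℂ)} :
    IsClosed[affineZariski σ] Z ↔
      ∃ T : Set (MvPolynomial σ ℂ), Z = {x | ∀ f ∈ T, MvPolynomial.eval x f = 0} := by
  have key : ∀ T : Set (MvPolynomial σ ℂ),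
      MvPolynomial.pointToPoint (k := ℂ) (K := ℂ) ⁻¹' PrimeSpectrum.zeroLocus T
        = {x : σ → ℂ | ∀ f ∈ T, MvPolynomial.eval x f = 0} := by
    intro T
    ext x
    simp only [Set.mem_preimage, PrimeSpectrum.mem_zeroLocus, MvPolynomial.pointToPoint,
      Set.subset_def, SetLike.mem_coe, MvPolynomial.mem_vanishingIdeal_singleton_iff]
    rfl
  rw [isClosed_induced_iff]
  constructor
  · rintro ⟨t, ht, rfl⟩
    obtain ⟨T, rfl⟩ := (PrimeSpectrum.isClosed_iff_zeroLocus _).1 ht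
    exact ⟨T, key T⟩
  · rintro ⟨T, rfl⟩
    exact ⟨_, PrimeSpectrum.isClosed_zeroLocus T, key T⟩

/-- The Zariski topology is coarser than the classical topology. -/
theorem isOpen_of_affineZariski {σ : Type*} {Z : Set (σ → ℂ)} (h : IsOpen[affineZariski σ] Z) :
    IsOpen Z := by
  rw [← isClosed_compl_iff]
  have h' : IsClosed[affineZariski σ] Zᶜ := (@isClosed_compl_iff _ (affineZariski σ) _).2 h
  obtain ⟨T, hT⟩ := isClosed_affineZariski_iff.1 h'
  rw [hT]
  have : {x : σ → ℂ | ∀ f ∈ T, MvPolynomial.eval x f = 0}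
      = ⋂ f ∈ T, {x | MvPolynomial.eval x f = 0} := by
    ext; simp
  rw [this]
  exact isClosed_biInter fun f _ =>
    isClosed_eq (MvPolynomial.continuous_eval f) continuous_const

theorem eval_eq_zero_of_dense {σ : Type*} {Z : Set (σ → ℂ)} (hZ : @Dense _ (affineZariski σ) Z)
    {f : MvPolynomial σ ℂ} (hf : ∀ z ∈ Z, MvPolynomial.eval z f = 0) : f = 0 := by
  refine MvPolynomial.funext fun x => ?_
  have hc : IsClosed[affineZariski σ] {x | MvPolynomial.eval x f = 0} :=
    isClosed_affineZariski_iff.2 ⟨{f}, by simp⟩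
  have h := (@IsClosed.closure_subset_iff _ (affineZariski σ) _ _ hc).2 hf
  have := h (hZ x)
  simpa using this

theorem isClosed_glZariski_iff {N : ℕ} {Z : Set (GL (Fin N) ℂ)} :
    IsClosed[glZariski N] Z ↔ ∃ T : Set (MvPolynomial (Fin N × Fin N) ℂ),
      Z = {g | ∀ f ∈ T, matEval f g.val = 0} := by
  rw [@isClosed_induced_iff _ _ (affineZariski (Fin N × Fin N))]
  constructor
  · rintro ⟨t, ht, rfl⟩
    obtain ⟨T, rfl⟩ := isClosed_affineZariski_iff.1 ht
    exact ⟨T, rfl⟩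
  · rintro ⟨T, rfl⟩
    exact ⟨_, isClosed_affineZariski_iff.2 ⟨T, rfl⟩, rfl⟩

/-- Polynomials are continuous for the classical topology. This is how classical curves in `GL_N(ℂ)`
yield Zariski connected sets. -/
theorem continuous_glZariski {N : ℕ} {X : Type*} [TopologicalSpace X] {c : X → GL (Fin N) ℂ}
    (hc : Continuous fun x => (c x).val) : @Continuous _ _ _ (glZariski N) c := by
  rw [@continuous_iff_isClosed _ _ _ (glZariski N)]
  intro Z hZ
  obtain ⟨T, rfl⟩ := isClosed_glZariski_iff.1 hZ
  have : c ⁻¹' {g | ∀ f ∈ T, matEval f g.val = 0} = ⋂ f ∈ T, {x | matEval f (c x).val = 0} := by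
    ext; simp
  rw [this]
  exact isClosed_biInter fun f _ =>
    isClosed_eq ((continuous_matEval f).comp hc) continuous_const

/-- Closed subgroups of `GL_N(ℂ)`, described by their vanishing polynomials. -/
def IsZariskiClosed {N : ℕ} (G : Subgroup (GL (Fin N) ℂ)) : Prop :=
  ∀ g : GL (Fin N) ℂ, (∀ f, (∀ h ∈ G, matEval f h.val = 0) → matEval f g.val = 0) → g ∈ G

theorem aeval_eq_matEval {N : ℕ} (p : MvPolynomial (Fin N × Fin N) ℝ) (g : GL (Fin N) ℂ) :
    MvPolynomial.aeval (entries g) p = matEval (p.map (algebraMap ℝ ℂ)) g.val := by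
  rw [matEval, MvPolynomial.eval_map]
  rfl

/-- The Lie theory below is complex and needs only this closedness; the real structure returns when
the relative invariant is made real. -/
theorem IsRealAlgebraic.isZariskiClosed {N : ℕ} {G : Subgroup (GL (Fin N) ℂ)}
    (hG : IsRealAlgebraic G) : IsZariskiClosed G := by
  obtain ⟨I, hI⟩ := hG
  intro g hg
  rw [hI, MvPolynomial.mem_zeroLocus_iff]
  intro p hp
  rw [aeval_eq_matEval]
  refine hg _ fun h hh => ?_
  rw [← aeval_eq_matEval]
  exact MvPolynomial.mem_zeroLocus_iff.1 ((hI h).1 hh) p hp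

end Zariski

/-! ### Regular functions -/

section Regular

variable {N : ℕ}

/-- The algebra of regular functions with coefficients in `R` on a set of invertible matrices. -/
def regularFunctions (R : Type*) [CommRing R] [Algebra R ℂ] (G : Subgroup (GL (Fin N) ℂ)) :
    Subalgebra R (G → ℂ) where
  carrier := {f | ∃ (p : MvPolynomial (Fin N × Fin N) R) (k : ℕ),
    ∀ g : G, f g = MvPolynomial.aeval (entries g.val) p * ((g.val.val.det)⁻¹) ^ k}
  algebraMap_mem' r := ⟨MvPolynomial.C r, 0, fun g => by simp⟩
  mul_mem' := by
    rintro f₁ f₂ ⟨p, k, hp⟩ ⟨q, l, hq⟩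
    exact ⟨p * q, k + l, fun g => by rw [Pi.mul_apply, hp, hq, map_mul]; ring⟩
  add_mem' := by
    rintro f₁ f₂ ⟨p, k, hp⟩ ⟨q, l, hq⟩
    let D : MvPolynomial (Fin N × Fin N) R :=
      (Matrix.of fun i j => MvPolynomial.X (i, j) : Matrix (Fin N) (Fin N) _).det
    have hD : ∀ g : GL (Fin N) ℂ, MvPolynomial.aeval (entries g) D = g.val.det := by
      intro g
      simp only [D, AlgHom.map_det]
      congr 1
      ext i j
      simp [entries]
    refine ⟨p * D ^ l + q * D ^ k, k + l, fun g => ?_⟩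
    have h0 : g.val.val.det ≠ 0 := (Matrix.GeneralLinearGroup.det g.val).ne_zero
    rw [Pi.add_apply, hp, hq]
    simp only [map_add, map_mul, map_pow, hD]
    have e1 : ∀ m : ℕ, (g.val.val.det) ^ m * ((g.val.val.det)⁻¹) ^ m = 1 := fun m => by
      rw [← mul_pow, mul_inv_cancel₀ h0, one_pow]
    rw [pow_add]
    linear_combination (-(MvPolynomial.aeval (entries g.val) p * ((g.val.val.det)⁻¹) ^ k)) * e1 l
      - (MvPolynomial.aeval (entries g.val) q * ((g.val.val.det)⁻¹) ^ l) * e1 k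

theorem entry_mem_regularFunctions (R : Type*) [CommRing R] [Algebra R ℂ]
    (G : Subgroup (GL (Fin N) ℂ)) (i j : Fin N) :
    (fun g : G => g.val.val i j) ∈ regularFunctions R G :=
  ⟨MvPolynomial.X (i, j), 0, fun g => by simp [entries]⟩

theorem det_mem_regularFunctions (R : Type*) [CommRing R] [Algebra R ℂ]
    (G : Subgroup (GL (Fin N) ℂ)) {κ : Type*} [Fintype κ] [DecidableEq κ]
    {F : G → Matrix κ κ ℂ} (hF : ∀ i j, (fun g => F g i j) ∈ regularFunctions R G) :
    (fun g => (F g).det) ∈ regularFunctions R G := by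
  have : (fun g => (F g).det)
      = ∑ σ : Equiv.Perm κ, (Equiv.Perm.sign σ) • ∏ i, fun g => F g (σ i) i := by
    funext g
    simp [Matrix.det_apply, Finset.sum_apply, Finset.prod_apply]
  rw [this]
  refine Subalgebra.sum_mem _ fun σ _ => ?_
  have hm : (∏ i, fun g => F g (σ i) i) ∈ regularFunctions R G :=
    Subalgebra.prod_mem _ fun i _ => hF _ _
  rcases Int.units_eq_one_or (Equiv.Perm.sign σ) with h | h
  · rw [h, one_smul]; exact hm
  · rw [h, Units.neg_smul, one_smul]; exact Subalgebra.neg_mem _ hm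

/-- Cramer's rule: the inverse is the adjugate divided by the determinant. -/
theorem inv_entry_mem_regularFunctions (R : Type*) [CommRing R] [Algebra R ℂ]
    (G : Subgroup (GL (Fin N) ℂ)) (i j : Fin N) :
    (fun g : G => (g.val⁻¹).val i j) ∈ regularFunctions R G := by
  have h1 : (fun g : G => (g.val.val.det)⁻¹) ∈ regularFunctions R G := ⟨1, 1, fun g => by simp⟩
  have h2 : (fun g : G => g.val.val.adjugate i j) ∈ regularFunctions R G := by
    simp only [Matrix.adjugate_apply]
    refine det_mem_regularFunctions R G fun k l => ?_
    by_cases hk : k = j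
    · subst hk
      simp only [Matrix.updateRow_self]
      by_cases hl : i = l
      · subst hl
        simpa only [Pi.single_eq_same] using! (regularFunctions R G).one_mem
      · simpa only [Pi.single_apply, Ne.symm hl, if_false] using! (regularFunctions R G).zero_mem
    · simpa [Matrix.updateRow_ne hk] using entry_mem_regularFunctions R G k l
  convert Subalgebra.mul_mem _ h1 h2 using 1
  funext g
  simp [Matrix.inv_def]

/-- Composition of a polynomial with inversion is regular. -/
theorem matEval_inv_regular (f : MvPolynomial (Fin N × Fin N) ℂ) :
    ∃ (p : MvPolynomial (Fin N × Fin N) ℂ) (k : ℕ), ∀ g : GL (Fin N) ℂ,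
      matEval f (g⁻¹).val = matEval p g.val * ((g.val.det)⁻¹) ^ k := by
  suffices h : (fun g : (⊤ : Subgroup (GL (Fin N) ℂ)) => matEval f (g.val⁻¹).val)
      ∈ regularFunctions ℂ ⊤ by
    obtain ⟨p, k, hp⟩ := h
    exact ⟨p, k, fun g => hp ⟨g, trivial⟩⟩
  induction f using MvPolynomial.induction_on with
  | C a => simpa only [matEval_C] using! (regularFunctions ℂ (⊤ : Subgroup (GL (Fin N) ℂ))).algebraMap_mem a
  | add p q hp hq => simpa only [matEval_add] using! Subalgebra.add_mem _ hp hq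
  | mul_X p ij hp =>
    simpa only [matEval_mul, matEval_X] using!
      Subalgebra.mul_mem _ hp (inv_entry_mem_regularFunctions ℂ ⊤ ij.1 ij.2)

/-! ### Zariski closures of subgroups. -/

/-- The Zariski closure of a subgroup of `GL_N(ℂ)`. -/
def zariskiClosure (S : Subgroup (GL (Fin N) ℂ)) : Subgroup (GL (Fin N) ℂ) where
  carrier := {g | ∀ f, (∀ h ∈ S, matEval f h.val = 0) → matEval f g.val = 0}
  one_mem' f hf := hf 1 S.one_mem
  mul_mem' := by
    intro a b ha hb f hf
    obtain ⟨fb, hfb⟩ := exists_matEval_mul_right f b.val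
    rw [Units.val_mul, ← hfb]
    -- Two passes: first the left factor is reduced to an element `s` of `S`, then the right factor
    -- to an element of `S`.
    refine ha fb fun s hs => ?_
    obtain ⟨fs, hfs⟩ := exists_matEval_mul_left f s.val
    rw [hfb, ← hfs]
    refine hb fs fun t ht => ?_
    rw [hfs, ← Units.val_mul]
    exact hf _ (S.mul_mem hs ht)
  inv_mem' := by
    intro a ha f hf
    obtain ⟨p, k, hp⟩ := matEval_inv_regular f
    rw [hp, ha p, zero_mul]
    intro s hs
    have h := hp s
    rw [hf _ (S.inv_mem hs)] at h
    have h0 : ((s.val.det)⁻¹) ^ k ≠ 0 :=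
      pow_ne_zero _ (inv_ne_zero (Matrix.GeneralLinearGroup.det s).ne_zero)
    exact (mul_eq_zero.1 h.symm).resolve_right h0

theorem le_zariskiClosure (S : Subgroup (GL (Fin N) ℂ)) : S ≤ zariskiClosure S :=
  fun g hg _ hf => hf g hg

theorem isClosed_zariskiClosure (S : Subgroup (GL (Fin N) ℂ)) :
    IsClosed[glZariski N] (zariskiClosure S : Set (GL (Fin N) ℂ)) :=
  isClosed_glZariski_iff.2 ⟨{f | ∀ h ∈ S, matEval f h.val = 0}, rfl⟩

theorem zariskiClosure_le {S G : Subgroup (GL (Fin N) ℂ)} (hG : IsZariskiClosed G) (h : S ≤ G) :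
    zariskiClosure S ≤ G :=
  fun g hg => hG g fun f hf => hg f fun s hs => hf s (h hs)

theorem isConnectedGroup_zariskiClosure {S : Subgroup (GL (Fin N) ℂ)}
    (hS : @IsPreconnected _ (glZariski N) (S : Set (GL (Fin N) ℂ))) :
    IsConnectedGroup (zariskiClosure S) := by
  refine ⟨⟨1, Subgroup.one_mem _⟩, ?_⟩
  refine @IsPreconnected.subset_closure _ (glZariski N) _ _ hS (le_zariskiClosure S) ?_
  intro g hg
  have hc := @isClosed_closure _ (glZariski N) (S : Set (GL (Fin N) ℂ))
  obtain ⟨T, hT⟩ := isClosed_glZariski_iff.1 hc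
  rw [hT]
  intro f hf
  refine hg f fun s hs => ?_
  have : s ∈ @closure _ (glZariski N) (S : Set (GL (Fin N) ℂ)) :=
    @subset_closure _ (glZariski N) _ _ hs
  rw [hT] at this
  exact this f hf

/-- Conjugation by `g` is polynomial in the matrix, so a polynomial vanishing on `S` pulls back to
another one vanishing on `S`. -/
theorem zariskiClosure_normal {S G : Subgroup (GL (Fin N) ℂ)}
    (h : ∀ g ∈ G, ∀ s ∈ S, g * s * g⁻¹ ∈ S) :
    ((zariskiClosure S).subgroupOf G).Normal := by
  refine ⟨fun u hu g => ?_⟩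
  rw [Subgroup.mem_subgroupOf] at hu ⊢
  intro f hf
  obtain ⟨f₁, hf₁⟩ := exists_matEval_mul_left f g.val.val
  obtain ⟨f₂, hf₂⟩ := exists_matEval_mul_right f₁ (g.val⁻¹).val
  have key : ∀ v : GL (Fin N) ℂ, matEval f₂ v.val = matEval f (g.val * v * g.val⁻¹).val := by
    intro v
    rw [hf₂, hf₁, Units.val_mul, Units.val_mul, mul_assoc]
  have := hu f₂ fun s hs => by rw [key]; exact hf _ (h _ g.2 s hs)
  rw [key] at this
  exact this

end Regular

end

end PVS

namespace PVS

noncomputable section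

open NormedSpace (exp)

/-! ### Derivatives of polynomial functions of a matrix -/

section Derivative

variable {ι : Type*} [Fintype ι]

/-- The differential of a polynomial function at `M`. -/
def matDeriv (f : MvPolynomial (ι × ι) ℂ) (M : Matrix ι ι ℂ) : Matrix ι ι ℂ →ₗ[ℂ] ℂ where
  toFun A := ∑ ij : ι × ι, matEval (MvPolynomial.pderiv ij f) M * A ij.1 ij.2
  map_add' A B := by simp [mul_add, Finset.sum_add_distrib]
  map_smul' c A := by simp [Finset.mul_sum, mul_left_comm]

theorem matDeriv_apply (f : MvPolynomial (ι × ι) ℂ) (M A : Matrix ι ι ℂ) :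
    matDeriv f M A = ∑ ij : ι × ι, matEval (MvPolynomial.pderiv ij f) M * A ij.1 ij.2 := rfl

/-- Entrywise derivative of a curve of matrices. -/
def HasMatDerivAt (c : ℂ → Matrix ι ι ℂ) (c' : Matrix ι ι ℂ) (t : ℂ) : Prop :=
  ∀ i j, HasDerivAt (fun t => c t i j) (c' i j) t

theorem HasMatDerivAt.mul {a b : ℂ → Matrix ι ι ℂ} {a' b' : Matrix ι ι ℂ} {t : ℂ}
    (ha : HasMatDerivAt a a' t) (hb : HasMatDerivAt b b' t) :
    HasMatDerivAt (fun t => a t * b t) (a' * b t + a t * b') t := by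
  intro i j
  have h := HasDerivAt.fun_sum (u := Finset.univ) fun k (_ : k ∈ Finset.univ) =>
    (ha i k).mul (hb k j)
  simp only [Matrix.mul_apply, Matrix.add_apply, ← Finset.sum_add_distrib]
  exact h

theorem hasMatDerivAt_const (M : Matrix ι ι ℂ) (t : ℂ) : HasMatDerivAt (fun _ => M) 0 t :=
  fun i j => hasDerivAt_const t (M i j)

theorem HasMatDerivAt.unique {c : ℂ → Matrix ι ι ℂ} {a b : Matrix ι ι ℂ} {t : ℂ}
    (ha : HasMatDerivAt c a t) (hb : HasMatDerivAt c b t) : a = b := by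
  ext i j
  exact (ha i j).unique (hb i j)

theorem hasDerivAt_matEval (f : MvPolynomial (ι × ι) ℂ) {c : ℂ → Matrix ι ι ℂ}
    {c' : Matrix ι ι ℂ} {t : ℂ} (hc : HasMatDerivAt c c' t) :
    HasDerivAt (fun t => matEval f (c t)) (matDeriv f (c t) c') t := by
  classical
  induction f using MvPolynomial.induction_on with
  | C a => simpa [matDeriv_apply, matEval] using hasDerivAt_const t a
  | add p q hp hq =>
    simp only [matEval_add]
    refine (hp.add hq).congr_deriv ?_
    simp [matDeriv_apply, add_mul, Finset.sum_add_distrib]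
  | mul_X p ij hp =>
    have hX : ∀ kl : ι × ι, matEval (MvPolynomial.pderiv kl (MvPolynomial.X ij)) (c t)
        = if kl = ij then 1 else 0 := by
      intro kl
      rw [MvPolynomial.pderiv_X, matEval]
      by_cases h : kl = ij
      · subst h; simp
      · simp [h, Ne.symm h]
    have h := hp.mul (hc ij.1 ij.2)
    simp only [matEval_mul, matEval_X]
    refine h.congr_deriv ?_
    simp only [matDeriv_apply, Derivation.leibniz, smul_eq_mul, matEval_add, matEval_mul, matEval_X,
      hX, add_mul, Finset.sum_add_distrib, mul_ite, mul_one, mul_zero, ite_mul, zero_mul,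
      Finset.sum_ite_eq', Finset.mem_univ, if_true, Finset.sum_mul]
    rw [add_comm]
    congr 1
    exact Finset.sum_congr rfl fun _ _ => by ring

variable [DecidableEq ι]

open scoped Matrix.Norms.Operator in
theorem hasDerivAt_exp_smul_matrix (A : Matrix ι ι ℂ) (t : ℂ) :
    HasDerivAt (fun t : ℂ => exp (t • A)) (exp (t • A) * A) t :=
  hasDerivAt_exp_smul_const A t

open scoped Matrix.Norms.Operator in
theorem hasMatDerivAt_exp_smul (A : Matrix ι ι ℂ) (t : ℂ) :
    HasMatDerivAt (fun t : ℂ => exp (t • A)) (exp (t • A) * A) t := by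
  intro i j
  let e : Matrix ι ι ℂ →L[ℂ] ℂ := LinearMap.toContinuousLinearMap (Matrix.entryLinearMap ℂ ℂ i j)
  exact e.hasFDerivAt.comp_hasDerivAt t (hasDerivAt_exp_smul_matrix A t)

theorem exp_smul_commute (A : Matrix ι ι ℂ) (t : ℂ) : exp (t • A) * A = A * exp (t • A) := by
  open scoped Matrix.Norms.Operator in
  exact (((Commute.refl A).smul_left t).exp_left).eq

theorem hasMatDerivAt_exp_smul_zero (A : Matrix ι ι ℂ) :
    HasMatDerivAt (fun t : ℂ => exp (t • A)) A 0 := by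
  simpa using hasMatDerivAt_exp_smul A 0

/-- A differentiable one-parameter family of matrices is an exponential. -/
theorem eq_exp_of_hasMatDerivAt {R : ℂ → Matrix ι ι ℂ} {D : Matrix ι ι ℂ} (h0 : R 0 = 1)
    (hmul : ∀ s t, R (s + t) = R s * R t) (hD : HasMatDerivAt R D 0) (t : ℂ) :
    R t = exp (t • D) := by
  have hR : ∀ t, HasMatDerivAt R (R t * D) t := by
    intro t
    have h1 : HasMatDerivAt (fun s => R (s - t)) D t := by
      intro i j
      exact HasDerivAt.comp_sub_const t t (f := fun t => R t i j) (by simpa using hD i j)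
    have h2 := (hasMatDerivAt_const (R t) t).mul h1
    intro i j
    have hs : (fun s => R s i j) = fun s => (R t * R (s - t)) i j := by
      funext s
      rw [← hmul, add_sub_cancel]
    rw [hs]
    simpa using h2 i j
  have hF : ∀ t, HasMatDerivAt (fun t => R t * exp (t • (-D))) 0 t := by
    intro t
    convert (hR t).mul (hasMatDerivAt_exp_smul (-D) t) using 1
    rw [exp_smul_commute]
    simp [mul_assoc]
  have hconst : R t * exp (t • (-D)) = 1 := by
    ext i j
    have := is_const_of_deriv_eq_zero (fun t => (hF t i j).differentiableAt)
      (fun t => (hF t i j).deriv) t 0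
    simpa [h0] using this
  calc R t = R t * (exp (t • (-D)) * exp (t • D)) := by
        rw [← Matrix.exp_add_of_commute]
        · simp
        · exact ((Commute.refl D).neg_left.smul_left t).smul_right t
    _ = exp (t • D) := by rw [← mul_assoc, hconst, one_mul]

end Derivative

/-! ### The Lie algebra of a closed subgroup of `GL_N(ℂ)` -/

section Lie

variable {N : ℕ}

/-- The exponential, as an invertible matrix. -/
def expGL (A : Matrix (Fin N) (Fin N) ℂ) : GL (Fin N) ℂ :=
  ⟨exp A, exp (-A),
    by rw [← Matrix.exp_add_of_commute _ _ ((Commute.refl A).neg_right)]; simp,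
    by rw [← Matrix.exp_add_of_commute _ _ ((Commute.refl A).neg_left)]; simp⟩

@[simp] theorem expGL_val (A : Matrix (Fin N) (Fin N) ℂ) : (expGL A).val = exp A := rfl

theorem expGL_zero : expGL (0 : Matrix (Fin N) (Fin N) ℂ) = 1 := by
  ext1; simp

theorem expGL_add_smul (A : Matrix (Fin N) (Fin N) ℂ) (s t : ℂ) :
    expGL ((s + t) • A) = expGL (s • A) * expGL (t • A) := by
  apply Units.ext
  rw [Units.val_mul, expGL_val, expGL_val, expGL_val, add_smul]
  exact Matrix.exp_add_of_commute _ _ (((Commute.refl A).smul_left s).smul_right t)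

theorem expGL_nsmul (A : Matrix (Fin N) (Fin N) ℂ) (k : ℕ) : expGL (k • A) = expGL A ^ k := by
  apply Units.ext
  rw [Units.val_pow_eq_pow_val, expGL_val, expGL_val, Matrix.exp_nsmul]

theorem expGL_conj (g : GL (Fin N) ℂ) (A : Matrix (Fin N) (Fin N) ℂ) :
    expGL (g.val * A * g⁻¹.val) = g * expGL A * g⁻¹ := by
  apply Units.ext
  rw [Units.val_mul, Units.val_mul, expGL_val, expGL_val]
  exact Matrix.exp_units_conj g A

/-- The Lie algebra of a closed subgroup. -/
def lieAlg (G : Subgroup (GL (Fin N) ℂ)) : Submodule ℂ (Matrix (Fin N) (Fin N) ℂ) where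
  carrier := {A | ∀ f, (∀ g ∈ G, matEval f g.val = 0) → matDeriv f 1 A = 0}
  zero_mem' f _ := map_zero _
  add_mem' ha hb f hf := by rw [map_add, ha f hf, hb f hf, add_zero]
  smul_mem' c A ha f hf := by rw [map_smul, ha f hf, smul_zero]

theorem mem_lieAlg {G : Subgroup (GL (Fin N) ℂ)} {A : Matrix (Fin N) (Fin N) ℂ} :
    A ∈ lieAlg G ↔ ∀ f, (∀ g ∈ G, matEval f g.val = 0) → matDeriv f 1 A = 0 := Iff.rfl

theorem mem_lieAlg_of_exp {G : Subgroup (GL (Fin N) ℂ)} {A : Matrix (Fin N) (Fin N) ℂ}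
    (h : ∀ t : ℂ, expGL (t • A) ∈ G) : A ∈ lieAlg G := by
  rw [mem_lieAlg]
  intro f hf
  have h1 := hasDerivAt_matEval f (hasMatDerivAt_exp_smul A 0)
  have h2 : (fun t : ℂ => matEval f (exp (t • A))) = fun _ => 0 :=
    funext fun t => hf (expGL (t • A)) (h t)
  rw [h2] at h1
  simpa using (h1.unique (hasDerivAt_const _ _))

/-- The left invariant derivation attached to `A` preserves the vanishing ideal of `G`. -/
theorem exists_invariant_derivation (A : Matrix (Fin N) (Fin N) ℂ)
    (f : MvPolynomial (Fin N × Fin N) ℂ) :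
    ∃ f', ∀ M, matEval f' M = matDeriv f M (M * A) := by
  refine ⟨∑ ij : Fin N × Fin N, MvPolynomial.pderiv ij f *
    ∑ k, MvPolynomial.X (ij.1, k) * MvPolynomial.C (A k ij.2), fun M => ?_⟩
  simp [matDeriv_apply, Matrix.mul_apply]

/-- For `f` vanishing on `G`, the function `t ↦ f(exp(tA))` is entire. Its derivatives come from
applying the left invariant derivation of `A` repeatedly, which preserves the vanishing ideal, so
all its Taylor coefficients at `0` are zero. -/
theorem expGL_mem {G : Subgroup (GL (Fin N) ℂ)} (hG : IsZariskiClosed G)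
    {A : Matrix (Fin N) (Fin N) ℂ} (hA : A ∈ lieAlg G) (t : ℂ) : expGL (t • A) ∈ G := by
  refine hG _ fun f hf => ?_
  have key : ∀ k : ℕ, ∃ f', (∀ g ∈ G, matEval f' g.val = 0) ∧
      iteratedDeriv k (fun t : ℂ => matEval f (exp (t • A)))
        = fun t : ℂ => matEval f' (exp (t • A)) := by
    intro k
    induction k with
    | zero => exact ⟨f, hf, iteratedDeriv_zero⟩
    | succ k ih =>
      obtain ⟨f', hf', hk⟩ := ih
      obtain ⟨f'', hf''⟩ := exists_invariant_derivation A f'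
      refine ⟨f'', fun g hg => ?_, ?_⟩
      -- The left translate of `f'` by `g` also vanishes on `G`, so its differential at `1` kills
      -- `A`. Along the curve `g (1 + sA)` this differential is the invariant derivative of `f'` at
      -- `g`.
      · obtain ⟨p, hp⟩ := exists_matEval_mul_left f' g.val
        have h1 : matDeriv p 1 A = 0 := hA p fun h hh => by
          rw [hp, ← Units.val_mul]; exact hf' _ (G.mul_mem hg hh)
        have hc : HasMatDerivAt (fun s : ℂ => (1 : Matrix (Fin N) (Fin N) ℂ) + s • A) A 0 :=
          fun i j => by
            simpa using ((hasDerivAt_id (0 : ℂ)).mul_const (A i j)).const_add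
              ((1 : Matrix (Fin N) (Fin N) ℂ) i j)
        have h2 := hasDerivAt_matEval p hc
        have h3 := hasDerivAt_matEval f' ((hasMatDerivAt_const g.val 0).mul hc)
        simp only [hp] at h2
        rw [hf'']
        have h4 := h3.unique h2
        simp only [zero_smul, add_zero, mul_one, zero_add] at h4
        rw [h4, h1]
      · rw [iteratedDeriv_succ, hk]
        funext s
        rw [(hasDerivAt_matEval f' (hasMatDerivAt_exp_smul A s)).deriv, hf'']
  have hdiff : Differentiable ℂ (fun t : ℂ => matEval f (exp (t • A))) := fun s =>
    (hasDerivAt_matEval f (hasMatDerivAt_exp_smul A s)).differentiableAt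
  have := Complex.taylorSeries_eq_of_entire' (c := 0) (z := t) hdiff
  change matEval f (exp (t • A)) = 0
  rw [← this]
  have hz : ∀ k : ℕ, iteratedDeriv k (fun t : ℂ => matEval f (exp (t • A))) 0 = 0 := by
    intro k
    obtain ⟨f', hf', hk⟩ := key k
    rw [hk]
    simpa using hf' 1 G.one_mem
  simp [hz]

theorem mem_lieAlg_iff {G : Subgroup (GL (Fin N) ℂ)} (hG : IsZariskiClosed G)
    {A : Matrix (Fin N) (Fin N) ℂ} : A ∈ lieAlg G ↔ ∀ t : ℂ, expGL (t • A) ∈ G :=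
  ⟨fun h t => expGL_mem hG h t, mem_lieAlg_of_exp⟩

theorem conj_mem_lieAlg {G : Subgroup (GL (Fin N) ℂ)} (hG : IsZariskiClosed G)
    {A : Matrix (Fin N) (Fin N) ℂ} (hA : A ∈ lieAlg G) {g : GL (Fin N) ℂ} (hg : g ∈ G) :
    g.val * A * g⁻¹.val ∈ lieAlg G := by
  rw [mem_lieAlg_iff hG] at hA ⊢
  intro t
  have : t • (g.val * A * g⁻¹.val) = g.val * (t • A) * g⁻¹.val := by simp
  rw [this, expGL_conj]
  exact G.mul_mem (G.mul_mem hg (hA t)) (G.inv_mem hg)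

/-- `D` is the differential of the homomorphism `ρ`. -/
def IsDifferential {n : ℕ} {G : Subgroup (GL (Fin N) ℂ)} (ρ : G →* GL (Fin n) ℂ)
    (D : Matrix (Fin N) (Fin N) ℂ →ₗ[ℂ] Matrix (Fin n) (Fin n) ℂ) : Prop :=
  ∀ (A : Matrix (Fin N) (Fin N) ℂ) (g : G), g.val = expGL A → A ∈ lieAlg G →
    ρ g = expGL (D A)

theorem hasDerivAt_matEval_exp (p : MvPolynomial (Fin N × Fin N) ℂ)
    (A : Matrix (Fin N) (Fin N) ℂ) :
    HasDerivAt (fun t : ℂ => matEval p (exp (t • A))) (matDeriv p 1 A) 0 := by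
  simpa using hasDerivAt_matEval p (hasMatDerivAt_exp_smul A 0)

/-- An entry of `ρ` is `q / det^k`, and its formal derivative at `1` is `q' - k q(1) det'`. The
resulting linear map lives on all matrices and depends on the chosen presentations; it is the
differential of `ρ` only on `lieAlg G`, where the one-parameter group `ρ(exp(tA))` is determined by
its derivative at `0`. -/
theorem exists_isDifferential {n : ℕ} {G : Subgroup (GL (Fin N) ℂ)} (hG : IsZariskiClosed G)
    {ρ : G →* GL (Fin n) ℂ} (hρ : IsRealMorphism ρ) : ∃ D, IsDifferential ρ D := by
  choose p k hp using hρ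
  let Δ : MvPolynomial (Fin N × Fin N) ℂ :=
    (Matrix.of fun i j => MvPolynomial.X (i, j) : Matrix (Fin N) (Fin N) _).det
  have hΔ : ∀ M, matEval Δ M = M.det := by
    intro M
    simp only [Δ, matEval, RingHom.map_det]
    congr 1
    ext i j
    simp
  let q := fun i j => (p i j).map (algebraMap ℝ ℂ)
  let D : Matrix (Fin N) (Fin N) ℂ →ₗ[ℂ] Matrix (Fin n) (Fin n) ℂ :=
    { toFun := fun A => Matrix.of fun i j =>
        matDeriv (q i j) 1 A - matEval (q i j) 1 * k i j * matDeriv Δ 1 A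
      map_add' := fun A B => by ext i j; simp; ring
      map_smul' := fun c A => by ext i j; simp; ring }
  refine ⟨D, fun A g hg hA => ?_⟩
  let R : ℂ → Matrix (Fin n) (Fin n) ℂ := fun t => (ρ ⟨expGL (t • A), expGL_mem hG hA t⟩).val
  have h0 : R 0 = 1 := by
    have : (⟨expGL ((0 : ℂ) • A), expGL_mem hG hA 0⟩ : G) = 1 :=
      Subtype.ext (by simp [expGL_zero])
    simp only [R, this, map_one, Units.val_one]
  have hmul : ∀ s t, R (s + t) = R s * R t := by
    intro s t
    simp only [R]
    rw [← Units.val_mul, ← map_mul]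
    congr 2
    exact Subtype.ext (expGL_add_smul A s t)
  have hR : ∀ i j t, R t i j = matEval (q i j) (exp (t • A))
      * ((matEval Δ (exp (t • A)))⁻¹) ^ k i j := by
    intro i j t
    have := hp i j ⟨expGL (t • A), expGL_mem hG hA t⟩
    rw [aeval_eq_matEval] at this
    simp only [R, hΔ]
    exact this
  have hD : HasMatDerivAt R (D A) 0 := by
    intro i j
    simp only [hR]
    have h1 := hasDerivAt_matEval_exp (q i j) A
    have h2 := hasDerivAt_matEval_exp Δ A
    have hΔ0 : matEval Δ (exp ((0 : ℂ) • A)) = 1 := by simp [hΔ]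
    have h3 := (h2.inv (by rw [hΔ0]; exact one_ne_zero)).pow (k i j)
    refine (h1.mul h3).congr_deriv ?_
    simp only [Pi.inv_apply, Pi.pow_apply, hΔ0]
    simp [D, NormedSpace.exp_zero]
    ring
  have := eq_exp_of_hasMatDerivAt h0 hmul hD 1
  apply Units.ext
  rw [one_smul] at this
  rw [expGL_val, ← this]
  simp only [R]
  congr 2
  exact Subtype.ext (by simp only [hg, one_smul])

end Lie

end

end PVS

namespace PVS

noncomputable section

open NormedSpace (exp)

/-! ### Exponential polynomials -/

section ExponentialPolynomials

open Polynomial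

/-- The functions `t^k e^{γt}` are linearly independent. The operator `d/dt - γ₀` lowers the degree
of the coefficient of `e^{γ₀ t}`, while on a coefficient with `γ ≠ γ₀` it acts as `c ↦ c' + (γ - γ₀)
c`, which is injective. -/
theorem eq_zero_of_sum_eval_mul_exp_eq_zero (Γ : Finset ℂ) :
    ∀ c : ℂ → ℂ[X], (∀ t : ℂ, ∑ γ ∈ Γ, (c γ).eval t * Complex.exp (γ * t) = 0) →
      ∀ γ ∈ Γ, c γ = 0 := by
  induction Γ using Finset.induction_on with
  | empty => simp
  | insert γ₀ Γ hγ₀ ih =>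
    -- Inner induction on the number `d` of derivatives that kill the coefficient of `e^{γ₀ t}`;
    -- when `d = 0` that term is absent and the outer induction applies.
    have step : ∀ (d : ℕ) (c : ℂ → ℂ[X]), (derivative^[d] (c γ₀)) = 0 →
        (∀ t : ℂ, ∑ γ ∈ insert γ₀ Γ, (c γ).eval t * Complex.exp (γ * t) = 0) →
        ∀ γ ∈ insert γ₀ Γ, c γ = 0 := by
      intro d
      induction d with
      | zero =>
        intro c hc h γ hγ
        simp only [Function.iterate_zero, id] at hc
        simp only [Finset.sum_insert hγ₀, hc, eval_zero, zero_mul, zero_add] at h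
        rcases Finset.mem_insert.1 hγ with rfl | hγ
        · exact hc
        · exact ih c h γ hγ
      | succ d ihd =>
        intro c hc h
        have h' : ∀ t : ℂ, ∑ γ ∈ insert γ₀ Γ,
            (derivative (c γ) + C (γ - γ₀) * c γ).eval t * Complex.exp (γ * t) = 0 := by
          intro t
          have h1 : HasDerivAt (fun t : ℂ => ∑ γ ∈ insert γ₀ Γ, (c γ).eval t * Complex.exp (γ * t))
              (∑ γ ∈ insert γ₀ Γ, ((derivative (c γ)).eval t * Complex.exp (γ * t)
                + (c γ).eval t * (Complex.exp (γ * t) * γ))) t :=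
            HasDerivAt.fun_sum fun γ _ => ((c γ).hasDerivAt t).mul
              ((by simpa using (hasDerivAt_id t).const_mul γ :
                HasDerivAt (fun t => γ * t) γ t).cexp)
          have h2 := h1.unique (by simp only [h]; exact hasDerivAt_const t (0 : ℂ))
          have h3 := h t
          calc _ = ∑ γ ∈ insert γ₀ Γ, ((derivative (c γ)).eval t * Complex.exp (γ * t)
                + (c γ).eval t * (Complex.exp (γ * t) * γ))
                - γ₀ * ∑ γ ∈ insert γ₀ Γ, (c γ).eval t * Complex.exp (γ * t) := by
                rw [Finset.mul_sum, ← Finset.sum_sub_distrib]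
                refine Finset.sum_congr rfl fun γ _ => ?_
                simp only [eval_add, eval_mul, eval_C]
                ring
            _ = 0 := by rw [h2, h3]; simp
        have h0 := ihd (fun γ => derivative (c γ) + C (γ - γ₀) * c γ)
          (by simpa only [sub_self, C_0, zero_mul, add_zero, Function.iterate_succ_apply] using hc) h'
        have hΓ : ∀ γ ∈ Γ, c γ = 0 := by
          intro γ hγ
          by_contra hne
          have hγne : γ - γ₀ ≠ 0 := sub_ne_zero.2 fun e => hγ₀ (e ▸ hγ)
          have h1 := h0 γ (Finset.mem_insert_of_mem hγ)
          have h2 : derivative (c γ) = C (-(γ - γ₀)) * c γ := by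
            rw [C_neg]; linear_combination h1
          have h3 := degree_derivative_lt hne
          rw [h2, degree_C_mul (neg_ne_zero.2 hγne)] at h3
          exact lt_irrefl _ h3
        intro γ hγ
        rcases Finset.mem_insert.1 hγ with rfl | hγ
        · refine Polynomial.funext fun t => ?_
          have h1 := h t
          rw [Finset.sum_insert hγ₀, Finset.sum_eq_zero (fun γ hγ => by rw [hΓ γ hγ]; simp),
            add_zero] at h1
          simpa [Complex.exp_ne_zero] using h1
        · exact hΓ γ hγ
    intro c h
    exact step ((c γ₀).natDegree + 1) c (iterate_derivative_eq_zero (Nat.lt_succ_self _)) h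

/-- Formal exponential polynomials `∑ p_γ(t) e^{γ t}`. -/
abbrev ExpPoly : Type := AddMonoidAlgebra ℂ[X] ℂ

/-- Evaluation of exponential polynomials at a point for `t` and a character for `γ ↦ e^{γ t}`. -/
def ExpPoly.eval (t : ℂ) (χ : Multiplicative ℂ →* ℂ) : ExpPoly →+* ℂ :=
  AddMonoidAlgebra.liftNCRingHom (evalRingHom t) χ fun _ _ => Commute.all _ _

/-- The character `γ ↦ e^{γ t}`. -/
def expChar (t : ℂ) : Multiplicative ℂ →* ℂ where
  toFun γ := Complex.exp (γ.toAdd * t)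
  map_one' := by simp
  map_mul' a b := by simp [add_mul, Complex.exp_add]

theorem ExpPoly.eval_single (t : ℂ) (χ : Multiplicative ℂ →* ℂ) (γ : ℂ) (p : ℂ[X]) :
    ExpPoly.eval t χ (AddMonoidAlgebra.single γ p) = p.eval t * χ (.ofAdd γ) := by
  simp [ExpPoly.eval, AddMonoidAlgebra.liftNCRingHom]

/-- An identity of functions of `t` thereby becomes formal, so it may be evaluated at any other
point and any other character of `ℂ`. -/
theorem ExpPoly.eq_zero_of_eval {c : ExpPoly} (h : ∀ t, ExpPoly.eval t (expChar t) c = 0) :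
    c = 0 := by
  have := eq_zero_of_sum_eval_mul_exp_eq_zero c.coeff.support c.coeff (fun t => by
    rw [← h t]
    simp only [ExpPoly.eval, AddMonoidAlgebra.liftNCRingHom]
    simp [AddMonoidAlgebra.liftNC, expChar, Finsupp.sum])
  ext1
  ext1 γ
  by_cases hγ : γ ∈ c.coeff.support
  · exact this γ hγ
  · exact Finsupp.notMem_support_iff.1 hγ

/-- Constants as exponential polynomials. -/
def ExpPoly.const : ℂ →+* ExpPoly := AddMonoidAlgebra.singleZeroRingHom.comp Polynomial.C

theorem ExpPoly.eval_const (t : ℂ) (χ : Multiplicative ℂ →* ℂ) (a : ℂ) :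
    ExpPoly.eval t χ (ExpPoly.const a) = a := by
  have h : ExpPoly.const a = AddMonoidAlgebra.single 0 (Polynomial.C a) := rfl
  rw [h, ExpPoly.eval_single]
  simp

end ExponentialPolynomials

/-! ### The Jordan decomposition and the complex conjugate of the semisimple part -/

section Replica

variable {ι : Type*} [Fintype ι] [DecidableEq ι]

theorem exists_eigenbasis_of_isSemisimple {V : Type*} [AddCommGroup V] [Module ℂ V]
    [FiniteDimensional ℂ V] (b₀ : Module.Basis ι ℂ V) {s : Module.End ℂ V} (hs : s.IsSemisimple) :
    ∃ (b : Module.Basis ι ℂ V) (d : ι → ℂ), ∀ i, s (b i) = d i • b i := by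
  have htop : ⨆ μ, s.eigenspace μ = ⊤ := by
    rw [← Module.End.iSup_maxGenEigenspace_eq_top s]
    congr 1
    funext μ
    exact (hs.isFinitelySemisimple.maxGenEigenspace_eq_eigenspace μ).symm
  have hint : DirectSum.IsInternal s.eigenspace :=
    (DirectSum.isInternal_submodule_iff_iSupIndep_and_iSup_eq_top _).2
      ⟨s.eigenspaces_iSupIndep, htop⟩
  let b₁ := hint.collectedBasis fun μ => Module.Free.chooseBasis ℂ (s.eigenspace μ)
  let e := b₁.indexEquiv b₀
  refine ⟨b₁.reindex e, fun i => (e.symm i).1, fun i => ?_⟩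
  rw [Module.Basis.reindex_apply]
  exact Module.End.mem_eigenspace_iff.1 (hint.collectedBasis_mem _ (e.symm i))

theorem exists_jordan_decomposition (M : Matrix ι ι ℂ) :
    ∃ (P P' : Matrix ι ι ℂ) (d : ι → ℂ) (N : Matrix ι ι ℂ), P * P' = 1 ∧ P' * P = 1 ∧
      IsNilpotent N ∧ Commute (Matrix.diagonal d) N ∧ M = P * (Matrix.diagonal d + N) * P' := by
  obtain ⟨n, hnM, s, hsM, hn, hs, hns⟩ :=
    Module.End.exists_isNilpotent_isSemisimple (K := ℂ) (f := Matrix.toLin' M)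
  obtain ⟨b, d, hb⟩ := exists_eigenbasis_of_isSemisimple (Pi.basisFun ℂ ι) hs
  let A := LinearMap.toMatrixAlgEquiv b
  have hd : A s = Matrix.diagonal d := by
    ext i j
    rw [LinearMap.toMatrixAlgEquiv_apply, hb]
    by_cases h : i = j
    · subst h; simp
    · simp [Matrix.diagonal_apply_ne _ h, Ne.symm h]
  have hcomm : Commute s n :=
    Algebra.commute_of_mem_adjoin_singleton_of_commute hnM
      (Algebra.commute_of_mem_adjoin_self hsM).symm
  refine ⟨(Pi.basisFun ℂ ι).toMatrix b, b.toMatrix (Pi.basisFun ℂ ι), d, A n,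
    Module.Basis.toMatrix_mul_toMatrix_flip _ _, Module.Basis.toMatrix_mul_toMatrix_flip _ _,
    hn.map A, ?_, ?_⟩
  · rw [← hd]
    exact hcomm.map A
  · rw [← hd, ← map_add, add_comm, ← hns]
    have h := basis_toMatrix_mul_linearMap_toMatrix_mul_basis_toMatrix (Pi.basisFun ℂ ι) b
      (Pi.basisFun ℂ ι) b (Matrix.toLin' M)
    refine Eq.trans ?_ h.symm
    exact (LinearMap.toMatrix'_toLin' M).symm

theorem exp_smul_eq_sum_of_pow_eq_zero {N : Matrix ι ι ℂ} {K : ℕ} (hN : N ^ K = 0) (t : ℂ) :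
    exp (t • N) = ∑ k ∈ Finset.range K, ((k.factorial : ℂ)⁻¹ * t ^ k) • N ^ k := by
  rw [NormedSpace.exp_eq_tsum ℂ]
  simp only
  rw [tsum_eq_sum (s := Finset.range K)]
  · simp [smul_pow, smul_smul]
  · intro k hk
    rw [smul_pow, pow_eq_zero_of_le (by simpa using hk) hN, smul_zero, smul_zero]

/-- Chevalley's replica: `C` has the semisimple part of `M` with its eigenvalues complex conjugated.
The entries of `exp(tM)` are exponential polynomials, so a relation `f = 0` along `exp(tM)` is a
formal identity. Evaluating the polynomial parts at `0` and replacing `e^{γt}` by the character `γ ↦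
e^{conj(γ) u}` turns `exp(tM)` into `exp(uC)`. The trace of `MC` is the sum of the `|d i|²`, so it
vanishes only when the semisimple part of `M` does. -/
theorem exists_replica (M : Matrix ι ι ℂ) :
    ∃ C : Matrix ι ι ℂ, (∀ f : MvPolynomial (ι × ι) ℂ, (∀ t : ℂ, matEval f (exp (t • M)) = 0) →
      ∀ u : ℂ, matEval f (exp (u • C)) = 0) ∧ ((M * C).trace = 0 → IsNilpotent M) := by
  obtain ⟨P, P', d, N, hP, hP', hN, hdN, rfl⟩ := exists_jordan_decomposition M
  have hconj : ∀ A : Matrix ι ι ℂ, exp (P * A * P') = P * exp A * P' := by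
    intro A
    have hinv : P' = P⁻¹ := (Matrix.inv_eq_right_inv hP).symm
    rw [hinv]
    exact Matrix.exp_conj P A ⟨⟨P, P', hP, hP'⟩, rfl⟩
  let d' : ι → ℂ := fun i => (starRingEnd ℂ) (d i)
  refine ⟨P * Matrix.diagonal d' * P', ?_, ?_⟩
  · obtain ⟨K, hK⟩ := hN
    let E : Matrix ι ι ExpPoly := Matrix.of fun i j => ∑ k ∈ Finset.range K,
      AddMonoidAlgebra.single 0
        (Polynomial.C ((k.factorial : ℂ)⁻¹ * (N ^ k) i j) * Polynomial.X ^ k)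
    -- The formal version of `exp(tM) = P exp(t diag d) exp(tN) P'`; the factor `exp(tN)`, encoded
    -- by `E`, is polynomial in `t`.
    let Y : Matrix ι ι ExpPoly := P.map ExpPoly.const *
      (Matrix.diagonal (fun i => AddMonoidAlgebra.single (d i) 1) * E) * P'.map ExpPoly.const
    have hY : ∀ (t : ℂ) (χ : Multiplicative ℂ →* ℂ), Y.map (ExpPoly.eval t χ)
        = P * (Matrix.diagonal (fun i => χ (.ofAdd (d i))) * exp (t • N)) * P' := by
      intro t χ
      have hE : E.map (ExpPoly.eval t χ) = exp (t • N) := by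
        ext i j
        rw [exp_smul_eq_sum_of_pow_eq_zero hK]
        simp only [E, Matrix.map_apply, Matrix.of_apply, map_sum, ExpPoly.eval_single,
          Matrix.sum_apply, Matrix.smul_apply, ofAdd_zero, map_one, mul_one]
        refine Finset.sum_congr rfl fun k _ => ?_
        simp
        ring
      have hc : ∀ Q : Matrix ι ι ℂ, (Q.map ExpPoly.const).map (ExpPoly.eval t χ) = Q := by
        intro Q
        ext i j
        simp [ExpPoly.eval_const]
      simp only [Y, Matrix.map_mul, hc, hE]
      congr 3
      ext i j
      by_cases h : i = j
      · subst h; simp [ExpPoly.eval_single]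
      · simp [h]
    have hF : ∀ (f : MvPolynomial (ι × ι) ℂ) (t : ℂ) (χ : Multiplicative ℂ →* ℂ),
        ExpPoly.eval t χ (MvPolynomial.eval₂ ExpPoly.const (fun ij => Y ij.1 ij.2) f)
          = matEval f (Y.map (ExpPoly.eval t χ)) := by
      intro f t χ
      rw [MvPolynomial.hom_eval₂, matEval]
      have : (ExpPoly.eval t χ).comp ExpPoly.const = RingHom.id ℂ :=
        RingHom.ext fun a => ExpPoly.eval_const t χ a
      rw [this]
      rfl
    intro f hf u
    have h0 : MvPolynomial.eval₂ ExpPoly.const (fun ij => Y ij.1 ij.2) f = 0 := by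
      refine ExpPoly.eq_zero_of_eval fun t => ?_
      rw [hF, hY, ← hf t]
      congr 1
      rw [← Matrix.smul_mul, ← Matrix.mul_smul, hconj, smul_add,
        Matrix.exp_add_of_commute _ _ ((hdN.smul_left t).smul_right t), ← Matrix.diagonal_smul,
        Matrix.exp_diagonal]
      congr 4
      funext i
      simp [expChar, Complex.exp_eq_exp_ℂ, NormedSpace.exp, mul_comm]
    -- Only the additivity of conjugation is used; this character does not come from a value of `t`.
    let χ : Multiplicative ℂ →* ℂ :=
      (expChar u).comp (AddMonoidHom.toMultiplicative (starRingEnd ℂ).toAddMonoidHom)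
    have h1 := hF f 0 χ
    rw [h0, map_zero, hY] at h1
    rw [h1]
    congr 1
    rw [← Matrix.smul_mul, ← Matrix.mul_smul, hconj, ← Matrix.diagonal_smul,
        Matrix.exp_diagonal]
    simp only [zero_smul, NormedSpace.exp_zero, mul_one]
    congr 3
    funext i
    simp [χ, expChar, Complex.exp_eq_exp_ℂ, d', mul_comm]
  · intro htr
    have hdN' : Commute (Matrix.diagonal d') N := by
      ext i j
      have h := congrFun (congrFun hdN.eq i) j
      simp only [Matrix.diagonal_mul, Matrix.mul_diagonal, d'] at h ⊢
      by_cases h0 : N i j = 0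
      · simp [h0]
      -- `N` commutes with `diag d`, so it only links indices with equal eigenvalues; hence it also
      -- commutes with the conjugate diagonal matrix.
      · have : d i = d j := by
          rw [mul_comm] at h
          exact mul_left_cancel₀ h0 h
        rw [this, mul_comm]
    have h1 : P * (Matrix.diagonal d + N) * P' * (P * Matrix.diagonal d' * P')
        = P * ((Matrix.diagonal d + N) * Matrix.diagonal d') * P' := by
      calc _ = P * (Matrix.diagonal d + N) * (P' * P) * Matrix.diagonal d' * P' := by
            simp only [mul_assoc]
        _ = _ := by rw [hP']; simp only [mul_assoc, mul_one]
    rw [h1, Matrix.trace_mul_cycle, hP', one_mul, add_mul, Matrix.trace_add] at htr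
    have h2 : (N * Matrix.diagonal d').trace = 0 :=
      (Matrix.isNilpotent_trace_of_isNilpotent
        (hdN'.symm.isNilpotent_mul_right hN)).eq_zero
    rw [h2, add_zero, Matrix.diagonal_mul_diagonal, Matrix.trace_diagonal] at htr
    have h3 : ∀ i, d i = 0 := by
      have h4 : ∑ i, Complex.normSq (d i) = 0 := by
        have : ((∑ i, Complex.normSq (d i) : ℝ) : ℂ) = 0 := by
          rw [← htr]; push_cast
          exact Finset.sum_congr rfl fun i _ => (Complex.mul_conj _).symm
        exact_mod_cast this
      intro i
      exact Complex.normSq_eq_zero.1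
        ((Finset.sum_eq_zero_iff_of_nonneg fun i _ => Complex.normSq_nonneg _).1 h4 i
          (Finset.mem_univ i))
    have h5 : Matrix.diagonal d = 0 := by
      rw [show d = 0 from funext h3]; exact Matrix.diagonal_zero
    obtain ⟨K, hK⟩ := hN
    refine ⟨K, ?_⟩
    rw [h5, zero_add]
    have : ∀ k : ℕ, (P * N * P') ^ k = P * N ^ k * P' := by
      intro k
      induction k with
      | zero => simp [hP]
      | succ k ih =>
        rw [pow_succ, ih, pow_succ]
        calc _ = P * N ^ k * (P' * P) * N * P' := by simp only [mul_assoc]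
          _ = _ := by rw [hP']; simp only [mul_assoc, mul_one]
    rw [this, hK]; simp

end Replica

end

end PVS

namespace PVS

noncomputable section

open NormedSpace (exp)

/-! ### Differentials of homomorphisms -/

section Differential

variable {N n : ℕ} {G : Subgroup (GL (Fin N) ℂ)}

theorem eq_of_forall_exp_smul_eq {ι : Type*} [Fintype ι] [DecidableEq ι] {A B : Matrix ι ι ℂ}
    (h : ∀ t : ℂ, exp (t • A) = exp (t • B)) : A = B := by
  have h1 := hasMatDerivAt_exp_smul_zero A
  simp only [h] at h1
  exact h1.unique (hasMatDerivAt_exp_smul_zero B)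

theorem IsDifferential.map_exp {ρ : G →* GL (Fin n) ℂ}
    {D : Matrix (Fin N) (Fin N) ℂ →ₗ[ℂ] Matrix (Fin n) (Fin n) ℂ} (hD : IsDifferential ρ D)
    {A : Matrix (Fin N) (Fin N) ℂ} (hA : A ∈ lieAlg G) {t : ℂ} (h : expGL (t • A) ∈ G) :
    ρ ⟨expGL (t • A), h⟩ = expGL (t • D A) := by
  rw [hD (t • A) ⟨_, h⟩ rfl (Submodule.smul_mem _ _ hA), map_smul]

theorem IsDifferential.conj (hG : IsZariskiClosed G) {ρ : G →* GL (Fin n) ℂ}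
    {D : Matrix (Fin N) (Fin N) ℂ →ₗ[ℂ] Matrix (Fin n) (Fin n) ℂ} (hD : IsDifferential ρ D)
    {A : Matrix (Fin N) (Fin N) ℂ} (hA : A ∈ lieAlg G) (g : G) :
    D (g.val.val * A * g.val⁻¹.val) = (ρ g).val * D A * (ρ g)⁻¹.val := by
  refine eq_of_forall_exp_smul_eq fun t => ?_
  have hA' := conj_mem_lieAlg hG hA g.2
  have h1 := hD.map_exp hA' (expGL_mem hG hA' t)
  have h2 := hD.map_exp hA (expGL_mem hG hA t)
  have h3 : (⟨expGL (t • (g.val.val * A * g.val⁻¹.val)), expGL_mem hG hA' t⟩ : G)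
      = g * ⟨expGL (t • A), expGL_mem hG hA t⟩ * g⁻¹ := by
    apply Subtype.ext
    have : t • (g.val.val * A * g.val⁻¹.val) = g.val.val * (t • A) * g.val⁻¹.val := by simp
    simp only [this, expGL_conj]
    rfl
  have h4 : t • ((ρ g).val * D A * (ρ g)⁻¹.val) = (ρ g).val * (t • D A) * (ρ g)⁻¹.val := by simp
  rw [h3, map_mul, map_mul, h2, map_inv, ← expGL_conj, ← h4] at h1
  exact (congrArg Units.val h1).symm

theorem IsDifferential.mem_lieAlg (hG : IsZariskiClosed G) {θ : G →* G}
    {D : Matrix (Fin N) (Fin N) ℂ →ₗ[ℂ] Matrix (Fin N) (Fin N) ℂ}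
    (hD : IsDifferential (G.subtype.comp θ) D) {A : Matrix (Fin N) (Fin N) ℂ}
    (hA : A ∈ lieAlg G) : D A ∈ lieAlg G := by
  refine mem_lieAlg_of_exp fun t => ?_
  rw [← hD.map_exp hA (expGL_mem hG hA t)]
  exact (θ _).2

theorem IsDifferential.comp_self (hG : IsZariskiClosed G) {θ : G →* G}
    {D : Matrix (Fin N) (Fin N) ℂ →ₗ[ℂ] Matrix (Fin N) (Fin N) ℂ}
    (hD : IsDifferential (G.subtype.comp θ) D) (hθ : ∀ g, θ (θ g) = g)
    {A : Matrix (Fin N) (Fin N) ℂ} (hA : A ∈ lieAlg G) : D (D A) = A := by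
  refine eq_of_forall_exp_smul_eq fun t => ?_
  have hA' := hD.mem_lieAlg hG hA
  have h1 := hD.map_exp hA (expGL_mem hG hA t)
  have h2 := hD.map_exp hA' (expGL_mem hG hA' t)
  have h3 : θ ⟨expGL (t • A), expGL_mem hG hA t⟩ = ⟨expGL (t • D A), expGL_mem hG hA' t⟩ :=
    Subtype.ext h1
  rw [MonoidHom.comp_apply, ← h3, hθ] at h2
  exact (congrArg Units.val h2).symm

/-- The bilinear form `tr(AB) + tr(θA θB)`. -/
def sumTraceForm (D : Matrix (Fin N) (Fin N) ℂ →ₗ[ℂ] Matrix (Fin N) (Fin N) ℂ)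
    (A B : Matrix (Fin N) (Fin N) ℂ) : ℂ :=
  (A * B).trace + (D A * D B).trace

theorem sumTraceForm_conj (hG : IsZariskiClosed G) {θ : G →* G}
    {D : Matrix (Fin N) (Fin N) ℂ →ₗ[ℂ] Matrix (Fin N) (Fin N) ℂ}
    (hD : IsDifferential (G.subtype.comp θ) D) {A B : Matrix (Fin N) (Fin N) ℂ}
    (hA : A ∈ lieAlg G) (hB : B ∈ lieAlg G) (g : G) :
    sumTraceForm D (g.val.val * A * g.val⁻¹.val) (g.val.val * B * g.val⁻¹.val)
      = sumTraceForm D A B := by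
  have key : ∀ (x : GL (Fin N) ℂ) (A B : Matrix (Fin N) (Fin N) ℂ),
      ((x.val * A * x⁻¹.val) * (x.val * B * x⁻¹.val)).trace = (A * B).trace := by
    intro x A B
    have : (x.val * A * x⁻¹.val) * (x.val * B * x⁻¹.val) = x.val * (A * B) * x⁻¹.val := by
      calc _ = x.val * A * (x⁻¹.val * x.val) * B * x⁻¹.val := by simp only [mul_assoc]
        _ = _ := by rw [Units.inv_mul]; simp only [mul_assoc, mul_one]
    rw [this, Matrix.trace_mul_cycle, Units.inv_mul, one_mul]
  rw [sumTraceForm, sumTraceForm, hD.conj hG hA, hD.conj hG hB, key, key]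

end Differential

/-! ### The radical of the trace form consists of nilpotent matrices -/

section Radical

variable {N : ℕ} {G : Subgroup (GL (Fin N) ℂ)}

theorem exp_smul_blockDiagonal (v : Fin 2 → Matrix (Fin N) (Fin N) ℂ) (t : ℂ) :
    exp (t • Matrix.blockDiagonal v) = Matrix.blockDiagonal fun k => exp (t • v k) := by
  rw [← Matrix.blockDiagonal_smul, Matrix.exp_blockDiagonal]
  congr 1
  funext k
  open scoped Matrix.Norms.Operator in
  exact Pi.coe_exp (t • v) k

/-- The matrix `diag(A, D A)` is tangent to the graph of `θ`. The graph is defined by polynomial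
relations, so the replica of this matrix is again of the form `diag(v, D v)` with `v` in the Lie
algebra. Its trace pairing with `diag(A, D A)` is the form at `(A, v)`, which is zero by assumption.
-/
theorem isNilpotent_of_forall_sumTraceForm_eq_zero (hG : IsZariskiClosed G) {θ : G →* G}
    (hθ : IsRealMorphism (G.subtype.comp θ))
    {D : Matrix (Fin N) (Fin N) ℂ →ₗ[ℂ] Matrix (Fin N) (Fin N) ℂ}
    (hD : IsDifferential (G.subtype.comp θ) D) {A : Matrix (Fin N) (Fin N) ℂ}
    (hA : A ∈ lieAlg G) (h : ∀ B ∈ lieAlg G, sumTraceForm D A B = 0) : IsNilpotent A := by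
  obtain ⟨C, hC, hnil⟩ := exists_replica (Matrix.blockDiagonal ![A, D A])
  choose p k hp using hθ
  let q := fun i j => (p i j).map (algebraMap ℝ ℂ)
  let Δ : MvPolynomial (Fin N × Fin N) ℂ :=
    (Matrix.of fun i j => MvPolynomial.X (i, j) : Matrix (Fin N) (Fin N) _).det
  have hΔ : ∀ M, matEval Δ M = M.det := by
    intro M
    simp only [Δ, matEval, RingHom.map_det]
    congr 1
    ext i j
    simp
  let r : MvPolynomial (Fin N × Fin N) ℂ → MvPolynomial ((Fin N × Fin 2) × (Fin N × Fin 2)) ℂ :=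
    MvPolynomial.rename fun ij => ((ij.1, 0), (ij.2, 0))
  have hr : ∀ f M, matEval (r f) M = matEval f (M.submatrix (fun i => (i, 0)) fun i => (i, 0)) := by
    intro f M
    simp only [matEval, r, MvPolynomial.eval_rename]
    rfl
  have hsub : ∀ v : Fin 2 → Matrix (Fin N) (Fin N) ℂ,
      (Matrix.blockDiagonal v).submatrix (fun i => (i, 0)) (fun i => (i, 0)) = v 0 := by
    intro v
    ext i j
    simp
  have hoff : ∀ i j k l, k ≠ l → C (i, k) (j, l) = 0 := by
    intro i j k l hkl
    have h1 := hC (MvPolynomial.X ((i, k), (j, l))) fun t => by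
      rw [exp_smul_blockDiagonal, matEval_X, Matrix.blockDiagonal_apply_ne _ _ _ hkl]
    have h2 := hasMatDerivAt_exp_smul_zero C (i, k) (j, l)
    simp only [matEval_X] at h1
    simp only [h1] at h2
    exact h2.unique (hasDerivAt_const _ _)
  obtain ⟨v, rfl⟩ : ∃ v : Fin 2 → Matrix (Fin N) (Fin N) ℂ, C = Matrix.blockDiagonal v := by
    refine ⟨fun k => Matrix.of fun i j => C (i, k) (j, k), ?_⟩
    ext ⟨i, k⟩ ⟨j, l⟩
    by_cases hkl : k = l
    · subst hkl; simp
    · rw [hoff i j k l hkl, Matrix.blockDiagonal_apply_ne _ _ _ hkl]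
  have hv0 : v 0 ∈ lieAlg G := by
    refine mem_lieAlg_of_exp fun u => hG _ fun f hf => ?_
    have h1 := hC (r f) (fun t => by
      rw [hr, exp_smul_blockDiagonal, hsub]
      exact hf (expGL (t • A)) (expGL_mem hG hA t)) u
    rwa [hr, exp_smul_blockDiagonal, hsub] at h1
  have hθexp : ∀ {B : Matrix (Fin N) (Fin N) ℂ} (hB : B ∈ lieAlg G) (i j : Fin N) (t : ℂ),
      (exp (t • D B)) i j * (exp (t • B)).det ^ k i j = matEval (q i j) (exp (t • B)) := by
    intro B hB i j t
    have h1 := hp i j ⟨expGL (t • B), expGL_mem hG hB t⟩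
    simp only [hD.map_exp hB, aeval_eq_matEval, expGL_val] at h1
    have h0 : (exp (t • B)).det ≠ 0 :=
      (Matrix.GeneralLinearGroup.det (expGL (t • B))).ne_zero
    rw [h1, mul_assoc, ← mul_pow, inv_mul_cancel₀ h0, one_pow, mul_one]
  have hv1 : v 1 = D (v 0) := by
    refine eq_of_forall_exp_smul_eq fun u => ?_
    ext i j
    -- The equation of the graph for the entry `(i, j)`, with the determinant in the denominator of
    -- `θ` cleared.
    have h1 := hC (r (q i j) - MvPolynomial.X ((i, 1), (j, 1)) * r Δ ^ k i j) (fun t => by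
      rw [exp_smul_blockDiagonal, matEval_sub, matEval_mul, matEval_pow, hr, hr, hsub, hΔ, matEval_X]
      simp [← hθexp hA]) u
    rw [exp_smul_blockDiagonal, matEval_sub, matEval_mul, matEval_pow, hr, hr, hsub, hΔ, matEval_X,
      ← hθexp hv0] at h1
    have h0 : (exp (u • v 0)).det ≠ 0 :=
      (Matrix.GeneralLinearGroup.det (expGL (u • v 0))).ne_zero
    simp only [Matrix.blockDiagonal_apply_eq] at h1
    exact mul_right_cancel₀ (pow_ne_zero _ h0) (sub_eq_zero.1 h1).symm
  obtain ⟨K, hK⟩ := hnil (by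
    rw [← Matrix.blockDiagonal_mul, Matrix.trace_blockDiagonal]
    simpa [hv1, sumTraceForm] using h _ hv0)
  refine ⟨K, ?_⟩
  rw [← Matrix.blockDiagonal_pow] at hK
  have h1 := hsub (![A, D A] ^ K)
  rw [hK] at h1
  simpa using h1.symm

/-- A subspace is the common kernel of linear functionals, and these commute with differentiation.
-/
theorem mem_of_hasMatDerivAt {W : Submodule ℂ (Matrix (Fin N) (Fin N) ℂ)}
    {c : ℂ → Matrix (Fin N) (Fin N) ℂ} {c' : Matrix (Fin N) (Fin N) ℂ} {t : ℂ}
    (hc : HasMatDerivAt c c' t) (hW : ∀ t, c t ∈ W) : c' ∈ W := by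
  by_contra hne
  obtain ⟨φ, hφ, hφW⟩ := Submodule.exists_le_ker_of_notMem hne
  have hφs : ∀ M, φ M = ∑ i, ∑ j, M i j * φ (Matrix.single i j 1) := by
    intro M
    refine (congrArg φ (Matrix.matrix_eq_sum_single M)).trans ?_
    simp only [map_sum]
    refine Finset.sum_congr rfl fun i _ => Finset.sum_congr rfl fun j _ => ?_
    rw [← smul_eq_mul, ← map_smul, Matrix.smul_single, smul_eq_mul, mul_one]
  have h1 : HasDerivAt (fun t => φ (c t)) (φ c') t := by
    rw [hφs c', show (fun t => φ (c t)) = fun t => ∑ i, ∑ j, c t i j * φ (Matrix.single i j 1) from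
      funext fun t => hφs (c t)]
    exact HasDerivAt.fun_sum fun i _ => HasDerivAt.fun_sum fun j _ => (hc i j).mul_const _
  have h2 : (fun t => φ (c t)) = fun _ => 0 := funext fun t => hφW (hW t)
  rw [h2] at h1
  exact hφ (h1.unique (hasDerivAt_const _ _))

/-- The radical of the trace form. -/
def traceRadical (G : Subgroup (GL (Fin N) ℂ))
    (D : Matrix (Fin N) (Fin N) ℂ →ₗ[ℂ] Matrix (Fin N) (Fin N) ℂ) :
    Submodule ℂ (Matrix (Fin N) (Fin N) ℂ) where
  carrier := {A | A ∈ lieAlg G ∧ ∀ B ∈ lieAlg G, sumTraceForm D A B = 0}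
  zero_mem' := ⟨zero_mem _, fun B _ => by simp [sumTraceForm]⟩
  add_mem' := by
    rintro A A' ⟨hA, h⟩ ⟨hA', h'⟩
    refine ⟨add_mem hA hA', fun B hB => ?_⟩
    have h1 := h B hB
    have h2 := h' B hB
    simp only [sumTraceForm, map_add, add_mul, Matrix.trace_add] at h1 h2 ⊢
    linear_combination h1 + h2
  smul_mem' := by
    rintro c A ⟨hA, h⟩
    refine ⟨Submodule.smul_mem _ c hA, fun B hB => ?_⟩
    have h1 := h B hB
    simp only [sumTraceForm, map_smul, Matrix.smul_mul, Matrix.trace_smul, smul_eq_mul] at h1 ⊢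
    linear_combination c * h1

theorem conj_mem_traceRadical (hG : IsZariskiClosed G) {θ : G →* G}
    {D : Matrix (Fin N) (Fin N) ℂ →ₗ[ℂ] Matrix (Fin N) (Fin N) ℂ}
    (hD : IsDifferential (G.subtype.comp θ) D) {A : Matrix (Fin N) (Fin N) ℂ}
    (hA : A ∈ traceRadical G D) {g : GL (Fin N) ℂ} (hg : g ∈ G) :
    g.val * A * g⁻¹.val ∈ traceRadical G D := by
  refine ⟨conj_mem_lieAlg hG hA.1 hg, fun B hB => ?_⟩
  have hB' := conj_mem_lieAlg hG hB (G.inv_mem hg)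
  have h1 := sumTraceForm_conj hG hD hA.1 hB' ⟨g, hg⟩
  have h2 : g.val * (g⁻¹.val * B * g⁻¹⁻¹.val) * g⁻¹.val = B := by
    rw [inv_inv]
    calc _ = (g.val * g⁻¹.val) * B * (g.val * g⁻¹.val) := by simp only [mul_assoc]
      _ = B := by rw [Units.mul_inv, one_mul, mul_one]
  simp only [h2] at h1
  rw [h1]
  exact hA.2 _ hB'

/-- The curve `exp(tA) B exp(-tA)` stays in the radical by conjugation invariance, and its
derivative at `0` is the commutator. -/
theorem commutator_mem_traceRadical (hG : IsZariskiClosed G) {θ : G →* G}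
    {D : Matrix (Fin N) (Fin N) ℂ →ₗ[ℂ] Matrix (Fin N) (Fin N) ℂ}
    (hD : IsDifferential (G.subtype.comp θ) D) {A B : Matrix (Fin N) (Fin N) ℂ}
    (hA : A ∈ traceRadical G D) (hB : B ∈ traceRadical G D) :
    A * B - B * A ∈ traceRadical G D := by
  have h1 := ((hasMatDerivAt_exp_smul_zero A).mul (hasMatDerivAt_const B 0)).mul
    (hasMatDerivAt_exp_smul_zero (-A))
  have h2 := mem_of_hasMatDerivAt h1 (W := traceRadical G D) fun t => by
    have := conj_mem_traceRadical hG hD hB (expGL_mem hG hA.1 t)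
    rw [smul_neg]
    exact this
  simpa [sub_eq_add_neg] using h2

end Radical

end

end PVS

namespace PVS

noncomputable section

open NormedSpace (exp)

/-! ### Unipotent groups attached to Lie algebras of nilpotent matrices -/

section Engel

variable {N : ℕ}

attribute [local instance] LieRing.ofAssociativeRing

/-- Engel's theorem for a space of nilpotent matrices closed under commutators. -/
theorem exists_flag_of_isNilpotent (𝔫 : Submodule ℂ (Matrix (Fin N) (Fin N) ℂ))
    (hbr : ∀ A ∈ 𝔫, ∀ B ∈ 𝔫, A * B - B * A ∈ 𝔫) (hnil : ∀ A ∈ 𝔫, IsNilpotent A) :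
    ∃ (V : ℕ → Submodule ℂ (Fin N → ℂ)) (K : ℕ), V 0 = ⊤ ∧ V K = ⊥ ∧
      (∀ k, V (k + 1) ≤ V k) ∧ ∀ A ∈ 𝔫, ∀ k, ∀ v ∈ V k, A.mulVec v ∈ V (k + 1) := by
  let L : LieSubalgebra ℂ (Module.End ℂ (Fin N → ℂ)) :=
    { 𝔫.comap (LinearMap.toMatrixAlgEquiv' : _ ≃ₐ[ℂ] Matrix (Fin N) (Fin N) ℂ).toLinearMap with
      lie_mem' := by
        intro f g hf hg
        have h := hbr _ hf _ hg
        change LinearMap.toMatrixAlgEquiv' ⁅f, g⁆ ∈ 𝔫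
        rw [Ring.lie_def, map_sub, map_mul, map_mul]
        exact h }
  have hL : LieModule.IsNilpotent L (Fin N → ℂ) := by
    rw [LieModule.isNilpotent_iff_forall' (R := ℂ)]
    intro x
    have h := (hnil _ x.2).map (LinearMap.toMatrixAlgEquiv' :
      _ ≃ₐ[ℂ] Matrix (Fin N) (Fin N) ℂ).symm
    change IsNilpotent (LinearMap.toMatrixAlgEquiv'.symm (LinearMap.toMatrixAlgEquiv' x.1)) at h
    rw [AlgEquiv.symm_apply_apply] at h
    exact h
  obtain ⟨K, hK⟩ := (LieModule.isNilpotent_iff ℂ L (Fin N → ℂ)).1 hL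
  refine ⟨fun k => (LieModule.lowerCentralSeries ℂ L (Fin N → ℂ) k).toSubmodule, K, rfl,
    by simp only [hK]; rfl, fun k => ?_, fun A hA k v hv => ?_⟩
  · exact LieModule.antitone_lowerCentralSeries ℂ L (Fin N → ℂ) (Nat.le_succ k)
  · have hA' : LinearMap.toMatrixAlgEquiv'.symm A ∈ L := by
      change LinearMap.toMatrixAlgEquiv' (LinearMap.toMatrixAlgEquiv'.symm A) ∈ 𝔫
      rw [AlgEquiv.apply_symm_apply]
      exact hA
    have h : ⁅(⟨_, hA'⟩ : L), v⁆ ∈ LieModule.lowerCentralSeries ℂ L (Fin N → ℂ) (k + 1) := by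
      rw [LieModule.lowerCentralSeries_succ]
      exact LieSubmodule.lie_mem_lie (LieSubmodule.mem_top _) hv
    exact h

/-- The group generated by the exponentials of a set of matrices. -/
def expClosure (𝔫 : Set (Matrix (Fin N) (Fin N) ℂ)) : Subgroup (GL (Fin N) ℂ) :=
  Subgroup.closure (expGL '' 𝔫)

theorem continuous_expGL_smul (A : Matrix (Fin N) (Fin N) ℂ) :
    Continuous fun t : ℂ => expGL (t • A) := by
  rw [Units.continuous_iff]
  have h : ∀ B : Matrix (Fin N) (Fin N) ℂ, Continuous fun t : ℂ => exp (t • B) := by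
    intro B
    open scoped Matrix.Norms.Operator in
    exact NormedSpace.exp_continuous.comp (continuous_id.smul continuous_const)
  refine ⟨h A, ?_⟩
  have h2 : (fun t : ℂ => (expGL (t • A))⁻¹.val) = fun t : ℂ => exp (t • (-A)) := by
    funext t
    rw [smul_neg]
    rfl
  exact h2 ▸ h (-A)

/-- Each element is joined to `1` inside the group by a curve over `ℂ`: a product of exponentials,
or their inverses, with every exponent scaled by `t`. -/
theorem isPreconnected_expClosure (𝔫 : Submodule ℂ (Matrix (Fin N) (Fin N) ℂ)) :
    @IsPreconnected _ (glZariski N) (expClosure (𝔫 : Set (Matrix (Fin N) (Fin N) ℂ)) :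
      Set (GL (Fin N) ℂ)) := by
  have key : ∀ s ∈ expClosure (𝔫 : Set (Matrix (Fin N) (Fin N) ℂ)),
      ∃ c : ℂ → GL (Fin N) ℂ, Continuous c ∧ c 0 = 1 ∧ c 1 = s ∧
        ∀ t, c t ∈ expClosure (𝔫 : Set (Matrix (Fin N) (Fin N) ℂ)) := by
    intro s hs
    induction hs using Subgroup.closure_induction with
    | mem x hx =>
      obtain ⟨A, hA, rfl⟩ := hx
      refine ⟨fun t => expGL (t • A), continuous_expGL_smul A, by simp [expGL_zero], by simp,
        fun t => Subgroup.subset_closure ⟨t • A, 𝔫.smul_mem t hA, rfl⟩⟩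
    | one => exact ⟨fun _ => 1, continuous_const, rfl, rfl, fun _ => Subgroup.one_mem _⟩
    | mul x y _ _ ihx ihy =>
      obtain ⟨c, hc, h0, h1, hm⟩ := ihx
      obtain ⟨c', hc', h0', h1', hm'⟩ := ihy
      exact ⟨fun t => c t * c' t, hc.mul hc', by simp [h0, h0'], by simp [h1, h1'],
        fun t => Subgroup.mul_mem _ (hm t) (hm' t)⟩
    | inv x _ ih =>
      obtain ⟨c, hc, h0, h1, hm⟩ := ih
      exact ⟨fun t => (c t)⁻¹, hc.inv, by simp [h0], by simp [h1],
        fun t => Subgroup.inv_mem _ (hm t)⟩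
  refine @isPreconnected_of_forall _ (glZariski N) _ 1 fun s hs => ?_
  obtain ⟨c, hc, h0, h1, hm⟩ := key s hs
  refine ⟨Set.range c, ?_, ⟨0, h0⟩, ⟨1, h1⟩, ?_⟩
  · rintro _ ⟨t, rfl⟩; exact hm t
  · exact @isPreconnected_range _ _ _ (glZariski N) _ _
      (continuous_glZariski (Units.continuous_val.comp hc))

/-- Every exponential acts as the identity on the successive quotients of the Engel flag, and this
property defines a group. The exponent `K` is the length of the flag; it is uniform, so that the
relation extends to the Zariski closure. -/
theorem isNilpotent_sub_one_of_mem_expClosure (𝔫 : Submodule ℂ (Matrix (Fin N) (Fin N) ℂ))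
    (hbr : ∀ A ∈ 𝔫, ∀ B ∈ 𝔫, A * B - B * A ∈ 𝔫) (hnil : ∀ A ∈ 𝔫, IsNilpotent A) :
    ∃ K : ℕ, ∀ s ∈ expClosure (𝔫 : Set (Matrix (Fin N) (Fin N) ℂ)), (s.val - 1) ^ K = 0 := by
  obtain ⟨V, K, hV0, hVK, hVle, hV⟩ := exists_flag_of_isNilpotent 𝔫 hbr hnil
  have hexp : ∀ A ∈ 𝔫, ∀ k, ∀ v ∈ V k, (exp A - 1).mulVec v ∈ V (k + 1) := by
    intro A hA k v hv
    obtain ⟨m, hm⟩ := hnil A hA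
    -- The exponent is made a successor so that the constant term of the exponential sum can be
    -- split off.
    have hm' : A ^ (m + 1) = 0 := by rw [pow_succ, hm, zero_mul]
    have h1 := exp_smul_eq_sum_of_pow_eq_zero hm' 1
    rw [one_smul, Finset.sum_range_succ'] at h1
    have hp : ∀ j : ℕ, (A ^ j).mulVec v ∈ V k := by
      intro j
      induction j with
      | zero => simpa using hv
      | succ j ih =>
        rw [pow_succ', ← Matrix.mulVec_mulVec]
        exact hVle k (hV A hA k _ ih)
    rw [h1]
    simp only [pow_zero, Nat.factorial_zero, Nat.cast_one, inv_one, mul_one, one_smul,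
      add_sub_cancel_right, Matrix.sum_mulVec, Matrix.smul_mulVec]
    refine Submodule.sum_mem _ fun j _ => Submodule.smul_mem _ _ ?_
    rw [pow_succ', ← Matrix.mulVec_mulVec]
    exact hV A hA k _ (hp j)
  let U : Subgroup (GL (Fin N) ℂ) :=
    { carrier := {g | ∀ k, ∀ v ∈ V k,
        (g.val - 1).mulVec v ∈ V (k + 1) ∧ (g⁻¹.val - 1).mulVec v ∈ V (k + 1)}
      one_mem' := by intro k v hv; simp
      inv_mem' := by intro g hg k v hv; rw [inv_inv]; exact (hg k v hv).symm
      mul_mem' := by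
        have key : ∀ (a b : Matrix (Fin N) (Fin N) ℂ),
            (∀ k, ∀ v ∈ V k, (a - 1).mulVec v ∈ V (k + 1)) →
            (∀ k, ∀ v ∈ V k, (b - 1).mulVec v ∈ V (k + 1)) →
            ∀ k, ∀ v ∈ V k, (a * b - 1).mulVec v ∈ V (k + 1) := by
          intro a b ha hb k v hv
          have : a * b - 1 = (a - 1) * (b - 1) + (a - 1) + (b - 1) := by noncomm_ring
          rw [this, Matrix.add_mulVec, Matrix.add_mulVec, ← Matrix.mulVec_mulVec]
          exact add_mem (add_mem (ha k _ (hVle k (hb k v hv))) (ha k v hv)) (hb k v hv)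
        intro a b ha hb k v hv
        refine ⟨key _ _ (fun k v hv => (ha k v hv).1) (fun k v hv => (hb k v hv).1) k v hv, ?_⟩
        rw [mul_inv_rev]
        exact key _ _ (fun k v hv => (hb k v hv).2) (fun k v hv => (ha k v hv).2) k v hv }
  have hU : expClosure (𝔫 : Set (Matrix (Fin N) (Fin N) ℂ)) ≤ U := by
    rw [expClosure, Subgroup.closure_le]
    rintro _ ⟨A, hA, rfl⟩ k v hv
    exact ⟨hexp A hA k v hv, hexp (-A) (neg_mem hA) k v hv⟩
  refine ⟨K, fun s hs => ?_⟩
  have hk : ∀ (k : ℕ) (v : Fin N → ℂ), ((s.val - 1) ^ k).mulVec v ∈ V k := by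
    intro k
    induction k with
    | zero => intro v; rw [hV0]; trivial
    | succ k ih =>
      intro v
      rw [pow_succ', ← Matrix.mulVec_mulVec]
      exact (hU hs k _ (ih v)).1
  refine Matrix.ext_of_mulVec_single fun i => ?_
  have := hk K (Pi.single i 1)
  rw [hVK, Submodule.mem_bot] at this
  rw [this, Matrix.zero_mulVec]

theorem exists_matEval_pow_sub_one (K : ℕ) (i j : Fin N) :
    ∃ f : MvPolynomial (Fin N × Fin N) ℂ, ∀ M, matEval f M = ((M - 1) ^ K) i j := by
  let Y : Matrix (Fin N) (Fin N) (MvPolynomial (Fin N × Fin N) ℂ) :=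
    Matrix.of fun i j => MvPolynomial.X (i, j)
  refine ⟨((Y - 1) ^ K) i j, fun M => ?_⟩
  have h : (MvPolynomial.eval fun ij : Fin N × Fin N => M ij.1 ij.2).mapMatrix Y = M := by
    ext i j; simp [Y]
  have h2 : (MvPolynomial.eval fun ij : Fin N × Fin N => M ij.1 ij.2).mapMatrix ((Y - 1) ^ K)
      = (M - 1) ^ K := by
    rw [map_pow, map_sub, h, map_one]
  exact congrFun (congrFun h2 i) j

end Engel

/-! ### Nondegeneracy of the trace form of a reductive group -/

section Reductive

variable {N : ℕ} {G : Subgroup (GL (Fin N) ℂ)}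

/-- In a reductive group, a space of nilpotent matrices in the Lie algebra that is stable under
commutators and under conjugation by the group is trivial. -/
theorem eq_zero_of_nilpotent_ideal (hG : IsZariskiClosed G) (hred : IsReductive G)
    (𝔫 : Submodule ℂ (Matrix (Fin N) (Fin N) ℂ)) (hle : 𝔫 ≤ lieAlg G)
    (hbr : ∀ A ∈ 𝔫, ∀ B ∈ 𝔫, A * B - B * A ∈ 𝔫) (hnil : ∀ A ∈ 𝔫, IsNilpotent A)
    (hconj : ∀ g ∈ G, ∀ A ∈ 𝔫, g.val * A * g⁻¹.val ∈ 𝔫) : 𝔫 = ⊥ := by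
  set S := expClosure (𝔫 : Set (Matrix (Fin N) (Fin N) ℂ)) with hS
  have hSG : S ≤ G := by
    rw [hS, expClosure, Subgroup.closure_le]
    rintro _ ⟨A, hA, rfl⟩
    simpa using expGL_mem hG (hle hA) 1
  have hSconj : ∀ g ∈ G, ∀ s ∈ S, g * s * g⁻¹ ∈ S := by
    intro g hg s hs
    have : S ≤ S.comap (MulAut.conj g).toMonoidHom := by
      conv_lhs => rw [hS, expClosure]
      rw [Subgroup.closure_le]
      rintro _ ⟨A, hA, rfl⟩
      change g * expGL A * g⁻¹ ∈ S
      rw [← expGL_conj]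
      exact Subgroup.subset_closure ⟨_, hconj g hg A hA, rfl⟩
    exact this hs
  obtain ⟨K, hK⟩ := isNilpotent_sub_one_of_mem_expClosure 𝔫 hbr hnil
  -- The closure is a closed connected normal unipotent subgroup; it is unipotent because the
  -- entries of `(g - 1)^K` are polynomials vanishing on `S`.
  have htriv : zariskiClosure S = ⊥ := by
    refine hred _ (zariskiClosure_le hG hSG) (isClosed_zariskiClosure S)
      (isConnectedGroup_zariskiClosure (isPreconnected_expClosure 𝔫))
      (zariskiClosure_normal hSconj) fun u hu => ⟨K, ?_⟩
    ext i j
    obtain ⟨f, hf⟩ := exists_matEval_pow_sub_one (N := N) K i j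
    rw [← hf]
    exact hu f fun s hs => by rw [hf, hK s hs]; rfl
  rw [eq_bot_iff]
  intro A hA
  refine (Submodule.mem_bot ℂ).2 (eq_of_forall_exp_smul_eq fun t => ?_)
  have h1 : expGL (t • A) ∈ zariskiClosure S :=
    le_zariskiClosure S (Subgroup.subset_closure ⟨t • A, 𝔫.smul_mem t hA, rfl⟩)
  rw [htriv, Subgroup.mem_bot] at h1
  rw [smul_zero, NormedSpace.exp_zero]
  exact congrArg Units.val h1

/-- The radical satisfies all assumptions of `eq_zero_of_nilpotent_ideal`. -/
theorem sumTraceForm_nondegenerate (hG : IsZariskiClosed G) (hred : IsReductive G) {θ : G →* G}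
    (hθ : IsRealMorphism (G.subtype.comp θ))
    {D : Matrix (Fin N) (Fin N) ℂ →ₗ[ℂ] Matrix (Fin N) (Fin N) ℂ}
    (hD : IsDifferential (G.subtype.comp θ) D) {A : Matrix (Fin N) (Fin N) ℂ}
    (hA : A ∈ lieAlg G) (h : ∀ B ∈ lieAlg G, sumTraceForm D A B = 0) : A = 0 := by
  have := eq_zero_of_nilpotent_ideal hG hred (traceRadical G D) (fun A hA => hA.1)
    (fun A hA B hB => commutator_mem_traceRadical hG hD hA hB)
    (fun A hA => isNilpotent_of_forall_sumTraceForm_eq_zero hG hθ hD hA.1 hA.2)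
    (fun g hg A hA => conj_mem_traceRadical hG hD hA hg)
  have hA' : A ∈ traceRadical G D := ⟨hA, h⟩
  rw [this] at hA'
  exact (Submodule.mem_bot ℂ).1 hA'

end Reductive

end

end PVS

namespace PVS

noncomputable section

open NormedSpace (exp)
open scoped Topology

/-! ### The local structure of a closed subgroup near the identity -/

section LocalStructure

/-! ### Isolated common zeros of a family of functions. -/

section Normed

variable {E : Type*} [NormedAddCommGroup E] [NormedSpace ℂ E] [FiniteDimensional ℂ E]

/-- If the differentials of a family of functions have no common zero on a subspace, then the
functions have no common zero on this subspace near the origin, except the origin. -/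
theorem eventually_eq_zero_of_forall_eq_zero {κ : Type*} {f : κ → E → ℂ} {L : κ → E →L[ℂ] ℂ}
    (hf : ∀ k, HasFDerivAt (f k) (L k) 0) (hf0 : ∀ k, f k 0 = 0) {W : Submodule ℂ E}
    (hW : ∀ c ∈ W, (∀ k, L k c = 0) → c = 0) :
    ∀ᶠ c in 𝓝 (0 : E), c ∈ W → (∀ k, f k c = 0) → c = 0 := by
  by_contra hne
  obtain ⟨c, hc0, hc⟩ := Filter.exists_seq_forall_of_frequently (Filter.not_eventually.1 hne)
  push Not at hc
  have hprop : ProperSpace E := FiniteDimensional.proper ℂ E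
  -- A sequence of nonzero common zeros tending to `0` is normalized to the unit sphere. By
  -- compactness it has a limit direction in `W`, which every differential annihilates.
  let u : ℕ → E := fun j => ((‖c j‖⁻¹ : ℝ) : ℂ) • c j
  have hu : ∀ j, u j ∈ Metric.sphere (0 : E) 1 := by
    intro j
    have : ‖c j‖ ≠ 0 := norm_ne_zero_iff.2 (hc j).2.2
    simp [u, norm_smul, this]
  obtain ⟨a, ha, φ, hφ, hlim⟩ := (isCompact_sphere (0 : E) 1).tendsto_subseq hu
  have haW : a ∈ W := by
    have hcl : IsClosed (W : Set E) := W.closed_of_finiteDimensional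
    exact hcl.mem_of_tendsto hlim
      (Filter.Eventually.of_forall fun j => W.smul_mem _ (hc _).1)
  have hL : ∀ k, L k a = 0 := by
    intro k
    have h := (hasFDerivWithinAt_univ.2 (hf k)).lim (hc0.comp hφ.tendsto_atTop)
      (Filter.Eventually.of_forall fun _ => Set.mem_univ _) hlim
    refine tendsto_nhds_unique h ?_
    simp [hf0, (hc _).2.1 k]
  have h0 := hW a haW hL
  rw [h0] at ha
  simp at ha

end Normed

/-! ### Products of exponentials near the identity. -/

section Algebra

variable {𝔸 : Type*} [NormedRing 𝔸] [NormedAlgebra ℂ 𝔸] [CompleteSpace 𝔸]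

/-- The derivative at `0` is `p + q + r`, the identity, so the map is open at `0` by the inverse
function theorem. -/
theorem map_nhds_exp_mul_exp_mul_exp {p q r : 𝔸 →L[ℂ] 𝔸} (h : ∀ x, p x + q x + r x = x) :
    Filter.map (fun x => exp (p x) * exp (q x) * exp (r x)) (𝓝 0) = 𝓝 1 := by
  have h1 : ∀ p : 𝔸 →L[ℂ] 𝔸, HasStrictFDerivAt (fun x => exp (p x)) p 0 := by
    intro p
    have h2 : HasStrictFDerivAt (exp : 𝔸 → 𝔸) (1 : 𝔸 →L[ℂ] 𝔸) (p 0) := by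
      rw [map_zero]; exact hasStrictFDerivAt_exp_zero
    exact h2.comp 0 p.hasStrictFDerivAt
  have h3 := ((h1 p).mul' (h1 q)).mul' (h1 r)
  have h4 := h3.map_nhds_eq_of_surj (by
    rw [LinearMap.range_eq_top]
    intro x
    refine ⟨x, ?_⟩
    have hx := h x
    simp only [Pi.mul_apply, map_zero, NormedSpace.exp_zero, mul_one]
    simp
    rw [add_comm, add_comm (q x)]
    exact hx)
  have h5 : ((fun x => exp (p x)) * (fun x => exp (q x)) * fun x => exp (r x)) 0 = 1 := by
    simp
  rw [h5] at h4
  exact h4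

theorem contDiff_exp_linear {E : Type*} [NormedAddCommGroup E] [NormedSpace ℂ E]
    [FiniteDimensional ℂ E] (T : E →ₗ[ℂ] 𝔸) (φ : 𝔸 →L[ℂ] ℂ) :
    ContDiff ℝ 1 fun v => φ (exp (T v)) := by
  have h1 : ContDiff ℂ 1 (exp : 𝔸 → 𝔸) :=
    contDiff_iff_contDiffAt.2 fun x => (NormedSpace.exp_analytic x).contDiffAt
  exact (φ.contDiff.comp (h1.comp (LinearMap.toContinuousLinearMap T).contDiff)).restrict_scalars ℝ

end Algebra

open scoped Matrix.Norms.Operator in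
theorem contDiff_exp_linear_entry {N : ℕ} {E : Type*} [NormedAddCommGroup E] [NormedSpace ℂ E]
    [FiniteDimensional ℂ E] (T : E →ₗ[ℂ] Matrix (Fin N) (Fin N) ℂ) (i j : Fin N) :
    ContDiff ℝ 1 fun v => exp (T v) i j :=
  contDiff_exp_linear T (LinearMap.toContinuousLinearMap (Matrix.entryLinearMap ℂ ℂ i j))

variable {N : ℕ} {G : Subgroup (GL (Fin N) ℂ)}

open scoped Matrix.Norms.Operator in
theorem differentiable_matEval (f : MvPolynomial (Fin N × Fin N) ℂ) :
    Differentiable ℂ (matEval f) := by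
  intro M
  have h1 := (AnalyticOnNhd.eval_mvPolynomial f (fun ij => M ij.1 ij.2) trivial).differentiableAt
  let T : Matrix (Fin N) (Fin N) ℂ →L[ℂ] (Fin N × Fin N → ℂ) := LinearMap.toContinuousLinearMap
    (LinearMap.pi fun ij => Matrix.entryLinearMap ℂ ℂ ij.1 ij.2)
  exact DifferentiableAt.comp (f := T) M h1 T.differentiableAt

open scoped Matrix.Norms.Operator in
theorem exists_hasFDerivAt_matEval_exp (f : MvPolynomial (Fin N × Fin N) ℂ) :
    ∃ L : Matrix (Fin N) (Fin N) ℂ →L[ℂ] ℂ,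
      HasFDerivAt (fun M => matEval f (exp M)) L 0 ∧ ∀ A, L A = matDeriv f 1 A := by
  have h1 : DifferentiableAt ℂ (fun M : Matrix (Fin N) (Fin N) ℂ => matEval f (exp M)) 0 :=
    (differentiable_matEval f _).comp 0 (NormedSpace.exp_analytic 0).differentiableAt
  refine ⟨_, h1.hasFDerivAt, fun A => ?_⟩
  have h2 : HasDerivAt (fun t : ℂ => t • A) ((1 : ℂ) • A) 0 :=
    (hasDerivAt_id (0 : ℂ)).smul_const A
  rw [one_smul] at h2
  have h3 : HasFDerivAt (fun M : Matrix (Fin N) (Fin N) ℂ => matEval f (exp M))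
      (fderiv ℂ (fun M : Matrix (Fin N) (Fin N) ℂ => matEval f (exp M)) 0) ((0 : ℂ) • A) := by
    rw [zero_smul]; exact h1.hasFDerivAt
  have h4 := h3.comp_hasDerivAt (0 : ℂ) h2
  have h5 : HasDerivAt ((fun M : Matrix (Fin N) (Fin N) ℂ => matEval f (exp M)) ∘ fun t : ℂ => t • A)
      (matDeriv f 1 A) 0 := hasDerivAt_matEval_exp f A
  exact h4.unique h5

-- The polynomials vanishing on `G`, composed with `exp`, have differentials at `0` whose common
-- kernel is `lieAlg G`, which meets `W` only in `0`.
open scoped Matrix.Norms.Operator in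
theorem eventually_eq_zero_of_expGL_mem {W : Submodule ℂ (Matrix (Fin N) (Fin N) ℂ)}
    (hW : Disjoint (lieAlg G) W) :
    ∀ᶠ c in 𝓝 (0 : Matrix (Fin N) (Fin N) ℂ), c ∈ W → expGL c ∈ G → c = 0 := by
  choose L hL hL' using exists_hasFDerivAt_matEval_exp (N := N)
  let κ := {f : MvPolynomial (Fin N × Fin N) ℂ // ∀ g ∈ G, matEval f g.val = 0}
  have h := eventually_eq_zero_of_forall_eq_zero (κ := κ)
    (f := fun k M => matEval k.1 (exp M)) (L := fun k => L k.1) (fun k => hL k.1)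
    (fun k => by
      have := k.2 1 G.one_mem
      simpa using this) (W := W) (fun c hc h => by
      refine (Submodule.disjoint_def.1 hW) c (fun f hf => ?_) hc
      rw [← hL']
      exact h ⟨f, hf⟩)
  refine h.mono fun c hc hcW hcG => hc hcW fun k => k.2 (expGL c) hcG

open scoped Matrix.Norms.Operator in
theorem map_nhds_exp_mul_exp_mul_exp_matrix
    {p q r : Matrix (Fin N) (Fin N) ℂ →ₗ[ℂ] Matrix (Fin N) (Fin N) ℂ}
    (h : ∀ x, p x + q x + r x = x) :
    Filter.map (fun x => exp (p x) * exp (q x) * exp (r x)) (𝓝 0)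
      = 𝓝 (1 : Matrix (Fin N) (Fin N) ℂ) :=
  map_nhds_exp_mul_exp_mul_exp (p := LinearMap.toContinuousLinearMap p)
    (q := LinearMap.toContinuousLinearMap q) (r := LinearMap.toContinuousLinearMap r) h

/-- Near the identity, a closed subgroup consists of products of exponentials of elements of two
subspaces that span its Lie algebra. -/
theorem exists_nhds_one_exp_mul_exp (hG : IsZariskiClosed G)
    {𝔨 𝔪 : Submodule ℂ (Matrix (Fin N) (Fin N) ℂ)} (hsup : 𝔨 ⊔ 𝔪 = lieAlg G)
    (hdisj : Disjoint 𝔨 𝔪) :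
    ∃ V ∈ 𝓝 (1 : Matrix (Fin N) (Fin N) ℂ), ∀ g ∈ G, g.val ∈ V →
      ∃ a ∈ 𝔨, ∃ b ∈ 𝔪, g = expGL a * expGL b := by
  -- All matrices split as `𝔨 ⊕ 𝔪 ⊕ W`, with projections `p`, `q`, `r`.
  obtain ⟨W, hW⟩ := (lieAlg G).exists_isCompl
  have hW' : IsCompl 𝔨 (𝔪 ⊔ W) := by
    refine ⟨hdisj.disjoint_sup_right_of_disjoint_sup_left (by rw [hsup]; exact hW.1), ?_⟩
    rw [codisjoint_iff, ← sup_assoc, hsup]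
    exact hW.sup_eq_top
  let s := (lieAlg G).projection _ hW
  let r := LinearMap.id - s
  let p := 𝔨.projection _ hW'
  let q := s - p
  have hr : ∀ x, r x ∈ W := fun x => Submodule.sub_projection_mem hW x
  have hp : ∀ x, p x ∈ 𝔨 := fun x => Submodule.projection_apply_mem hW' x
  have hq : ∀ x, q x ∈ 𝔪 := by
    intro x
    have hs : s x ∈ 𝔨 ⊔ 𝔪 := by rw [hsup]; exact Submodule.projection_apply_mem hW x
    obtain ⟨a, ha, b, hb, hab⟩ := Submodule.mem_sup.1 hs
    have h1 : p x = a := by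
      have hx : x = a + (b + r x) := by
        rw [← add_assoc, hab]; simp [r]
      have h2 : p (b + r x) = 0 := (Submodule.projection_apply_eq_zero_iff hW').2
        (Submodule.add_mem_sup hb (hr x))
      have h3 : p a = a := Submodule.projection_apply_left hW' ⟨a, ha⟩
      rw [hx, map_add, h2, h3, add_zero]
    have h4 : q x = b := by
      change s x - p x = b
      rw [h1, ← hab, add_sub_cancel_left]
    rw [h4]
    exact hb
  have hsum : ∀ x, p x + q x + r x = x := by
    intro x
    simp [q, r]
  have hev := eventually_eq_zero_of_expGL_mem hW.1
  have hrc : Filter.Tendsto r (𝓝 0) (𝓝 0) := by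
    have : Continuous r := by
      open scoped Matrix.Norms.Operator in
      exact r.continuous_of_finiteDimensional
    simpa using this.tendsto 0
  refine ⟨_, (map_nhds_exp_mul_exp_mul_exp_matrix hsum) ▸ Filter.image_mem_map (hrc.eventually hev),
    ?_⟩
  rintro g hg ⟨x, hx, hxg⟩
  have hp' : expGL (p x) ∈ G := by
    simpa using expGL_mem hG (hsup ▸ Submodule.mem_sup_left (hp x) : p x ∈ lieAlg G) 1
  have hq' : expGL (q x) ∈ G := by
    simpa using expGL_mem hG (hsup ▸ Submodule.mem_sup_right (hq x) : q x ∈ lieAlg G) 1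
  have hg' : expGL (p x) * expGL (q x) * expGL (r x) = g := Units.ext hxg
  -- The first two factors lie in `G`, hence so does the third; being small and transversal to the
  -- Lie algebra, `r x` must vanish.
  have hr' : expGL (r x) ∈ G := by
    have : expGL (r x) = (expGL (p x) * expGL (q x))⁻¹ * g := by rw [← hg']; group
    rw [this]
    exact G.mul_mem (G.inv_mem (G.mul_mem hp' hq')) hg
  refine ⟨p x, hp x, q x, hq x, ?_⟩
  rw [← hg', hx (hr x) hr', expGL_zero, mul_one]

end LocalStructure

/-! ### The tangent space of an open orbit -/

section OpenOrbit

variable {N n : ℕ} {G : Subgroup (GL (Fin N) ℂ)}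

theorem hasDerivAt_vecMul_exp (x : Fin n → ℂ) (B : Matrix (Fin n) (Fin n) ℂ) (t : ℂ) (j : Fin n) :
    HasDerivAt (fun t : ℂ => Matrix.vecMul x (exp (t • B)) j)
      (Matrix.vecMul (Matrix.vecMul x B) (exp (t • B)) j) t := by
  have h := HasDerivAt.fun_sum (u := Finset.univ) fun i (_ : i ∈ Finset.univ) =>
    (hasMatDerivAt_exp_smul B t i j).const_mul (x i)
  rw [Matrix.vecMul_vecMul, ← exp_smul_commute]
  exact h

theorem vecMul_exp_of_vecMul_eq_zero {x : Fin n → ℂ} {B : Matrix (Fin n) (Fin n) ℂ}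
    (h : Matrix.vecMul x B = 0) (t : ℂ) : Matrix.vecMul x (exp (t • B)) = x := by
  funext j
  have h1 : ∀ t, HasDerivAt (fun t : ℂ => Matrix.vecMul x (exp (t • B)) j) 0 t := fun t => by
    simpa [h] using hasDerivAt_vecMul_exp x B t j
  have := is_const_of_deriv_eq_zero (fun t => (h1 t).differentiableAt) (fun t => (h1 t).deriv) t 0
  simpa using this

theorem vecMul_eq_zero_of_vecMul_exp {x : Fin n → ℂ} {B : Matrix (Fin n) (Fin n) ℂ}
    (h : ∀ t : ℂ, Matrix.vecMul x (exp (t • B)) = x) : Matrix.vecMul x B = 0 := by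
  funext j
  have h1 := hasDerivAt_vecMul_exp x B 0 j
  simp only [h] at h1
  simpa using h1.unique (hasDerivAt_const _ _)

/-- The infinitesimal action at `x`. -/
def infAction (D : Matrix (Fin N) (Fin N) ℂ →ₗ[ℂ] Matrix (Fin n) (Fin n) ℂ) (x : Fin n → ℂ) :
    Matrix (Fin N) (Fin N) ℂ →ₗ[ℂ] (Fin n → ℂ) where
  toFun A := Matrix.vecMul x (D A)
  map_add' A B := by rw [map_add, Matrix.vecMul_add]
  map_smul' c A := by rw [map_smul, Matrix.vecMul_smul]; rfl

theorem infAction_apply (D : Matrix (Fin N) (Fin N) ℂ →ₗ[ℂ] Matrix (Fin n) (Fin n) ℂ)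
    (x : Fin n → ℂ) (A : Matrix (Fin N) (Fin N) ℂ) :
    infAction D x A = Matrix.vecMul x (D A) := rfl

/-- A Zariski open orbit has the full tangent space. -/
theorem map_infAction_eq_top (hG : IsZariskiClosed G) {ρ : G →* GL (Fin n) ℂ}
    {D : Matrix (Fin N) (Fin N) ℂ →ₗ[ℂ] Matrix (Fin n) (Fin n) ℂ} (hD : IsDifferential ρ D)
    {x : Fin n → ℂ} (hx : IsOpen (orbit ρ x)) : (lieAlg G).map (infAction D x) = ⊤ := by
  by_contra hne
  set T := infAction D x with hT
  -- `𝔨` is the infinitesimal stabilizer of `x`, and `𝔪` a complement of it in `lieAlg G`. If the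
  -- tangent map is not onto, then `𝔪` has dimension less than `n`.
  let 𝔨 := lieAlg G ⊓ LinearMap.ker T
  obtain ⟨W, hW⟩ := 𝔨.exists_isCompl
  let 𝔪 := W ⊓ lieAlg G
  have hsup : 𝔨 ⊔ 𝔪 = lieAlg G := by
    rw [← sup_inf_assoc_of_le W (inf_le_left : 𝔨 ≤ lieAlg G), hW.sup_eq_top, top_inf_eq]
  have hdisj : Disjoint 𝔨 𝔪 := hW.1.mono_right inf_le_left
  obtain ⟨V, hV, hVG⟩ := exists_nhds_one_exp_mul_exp hG hsup hdisj
  have hrank : Module.finrank ℂ 𝔪 < n := by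
    have hinj : Function.Injective (T.domRestrict 𝔪) := by
      rw [← LinearMap.ker_eq_bot, LinearMap.ker_eq_bot']
      intro m hm
      have h1 : (m : Matrix (Fin N) (Fin N) ℂ) ∈ 𝔨 := ⟨m.2.2, hm⟩
      exact Subtype.ext (Submodule.disjoint_def.1 hdisj _ h1 m.2)
    have h2 := LinearMap.finrank_range_of_inj hinj
    have h3 : LinearMap.range (T.domRestrict 𝔪) ≤ (lieAlg G).map T := by
      rintro _ ⟨m, rfl⟩
      exact ⟨m, m.2.2, rfl⟩
    have h4 := Submodule.finrank_mono h3
    have h5 := Submodule.finrank_lt hne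
    rw [Module.finrank_fin_fun] at h5
    omega
  let e := Module.finBasis ℂ 𝔪
  let r := Module.finrank ℂ 𝔪
  let ψ : (Fin r → ℂ) →ₗ[ℂ] Matrix (Fin n) (Fin n) ℂ :=
    D ∘ₗ 𝔪.subtype ∘ₗ e.equivFun.symm.toLinearMap
  let S : Set (Matrix (Fin N) (Fin N) ℂ) := Set.range fun g : G => g.val.val
  have hS : ∀ M : S, ∃ g : G, g.val.val = M.1 := fun M => M.2
  choose γ hγ using hS
  let nb : Matrix (Fin N) (Fin N) ℂ → Set (Matrix (Fin N) (Fin N) ℂ) := fun M => {h | h * M⁻¹ ∈ V}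
  have hnb : ∀ M ∈ S, nb M ∈ 𝓝[S] M := by
    rintro _ ⟨g, rfl⟩
    refine mem_nhdsWithin_of_mem_nhds ?_
    have hc : Continuous fun h : Matrix (Fin N) (Fin N) ℂ => h * (g.val.val)⁻¹ :=
      continuous_id.matrix_mul continuous_const
    refine hc.continuousAt.preimage_mem_nhds ?_
    rw [← Matrix.coe_units_inv, Units.mul_inv]
    exact hV
  have hsc : SecondCountableTopology (Matrix (Fin N) (Fin N) ℂ) :=
    inferInstanceAs (SecondCountableTopology (Fin N → Fin N → ℂ))
  -- Second countability: countably many translates of the chart neighbourhood cover `G`.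
  obtain ⟨t, htS, htc, hcov⟩ := TopologicalSpace.countable_cover_nhdsWithin hnb
  let F : S → (Fin r → ℂ) → (Fin n → ℂ) := fun M v =>
    Matrix.vecMul (Matrix.vecMul x (exp (ψ v))) (ρ (γ M)).val
  have hF : ∀ M, ContDiff ℝ 1 (F M) := by
    intro M
    rw [contDiff_pi]
    intro j
    simp only [F, Matrix.vecMul, dotProduct]
    exact ContDiff.sum fun i _ => (ContDiff.sum fun k _ =>
      contDiff_const.mul (contDiff_exp_linear_entry ψ k i)).mul contDiff_const
  have hdim : ∀ M, dimH (Set.range (F M)) ≤ (2 * r : ℕ) := by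
    intro M
    have := (hF M).dimH_range_le
    rwa [finrank_real_of_complex, Module.finrank_fin_fun] at this
  -- An element of `G` near `g` is `exp(a) exp(b) g`. As `exp(a)` fixes `x`, the orbit near `x ρ(g)`
  -- is parametrized by `b ∈ 𝔪` alone.
  have hsub : orbit ρ x ⊆ ⋃ M ∈ {M : S | M.1 ∈ t}, Set.range (F M) := by
    rintro _ ⟨h, rfl⟩
    obtain ⟨M, hMt, hM⟩ := Set.mem_iUnion₂.1 (hcov ⟨h, rfl⟩)
    refine Set.mem_iUnion₂.2 ⟨⟨M, htS hMt⟩, hMt, ?_⟩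
    set g := γ ⟨M, htS hMt⟩ with hg
    have hgM : g.val.val = M := hγ ⟨M, htS hMt⟩
    have hmem : (h.val * g.val⁻¹).val ∈ V := by
      rw [Units.val_mul, Matrix.coe_units_inv, hgM]
      exact hM
    obtain ⟨a, ha, b, hb, hab⟩ := hVG _ (G.mul_mem h.2 (G.inv_mem g.2)) hmem
    have hag : expGL a ∈ G := by simpa using expGL_mem hG ha.1 1
    have hbg : expGL b ∈ G := by simpa using expGL_mem hG hb.2 1
    have hh : h = ⟨expGL a, hag⟩ * ⟨expGL b, hbg⟩ * g := by
      apply Subtype.ext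
      change h.val = expGL a * expGL b * g.val
      rw [← hab, inv_mul_cancel_right]
    refine ⟨e.equivFun ⟨b, hb⟩, ?_⟩
    have h1 : ψ (e.equivFun ⟨b, hb⟩) = D b := by simp [ψ]
    have h2 : Matrix.vecMul x (exp (D a)) = x := by
      simpa using vecMul_exp_of_vecMul_eq_zero (x := x) (B := D a) ha.2 1
    simp only [F]
    rw [h1, hh, map_mul, map_mul, hD a ⟨_, hag⟩ rfl ha.1, hD b ⟨_, hbg⟩ rfl hb.2, Units.val_mul,
      Units.val_mul, expGL_val, expGL_val, ← Matrix.vecMul_vecMul, ← Matrix.vecMul_vecMul, h2]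
  have hx0 : x ∈ orbit ρ x := ⟨1, by simp⟩
  -- A nonempty open set has full real dimension `2n`, whereas a countable union of `C¹` images of
  -- `ℂ^r` has dimension at most `2r`.
  have h1 : dimH (orbit ρ x) = (2 * n : ℕ) := by
    rw [Real.dimH_of_mem_nhds (hx.mem_nhds hx0), finrank_real_of_complex, Module.finrank_fin_fun]
  have htc' : {M : S | M.1 ∈ t}.Countable := htc.preimage Subtype.val_injective
  have h2 : dimH (orbit ρ x) ≤ (2 * r : ℕ) := by
    refine (dimH_mono hsub).trans ?_
    rw [dimH_bUnion htc']
    exact iSup₂_le fun M _ => hdim M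
  rw [h1] at h2
  have h3 : 2 * n ≤ 2 * r := by exact_mod_cast h2
  omega

end OpenOrbit

end

end PVS

namespace PVS

noncomputable section

open NormedSpace (exp)
open scoped Topology

/-! ### The Lie algebra of the stabilizer in an essentially symmetric space -/

section Stabilizer

variable {N n : ℕ} {G : Subgroup (GL (Fin N) ℂ)}

theorem mem_stabilizer_iff {ρ : G →* GL (Fin n) ℂ} {x : Fin n → ℂ} {g : GL (Fin N) ℂ} :
    g ∈ stabilizer ρ x ↔ ∃ h : g ∈ G, Matrix.vecMul x (ρ ⟨g, h⟩).val = x := by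
  constructor
  · rintro ⟨g, hg, rfl⟩
    exact ⟨g.2, hg⟩
  · rintro ⟨h, hg⟩
    exact ⟨⟨g, h⟩, hg, rfl⟩

theorem mem_fixedSubgroup_iff {θ : G →* G} {g : GL (Fin N) ℂ} :
    g ∈ fixedSubgroup θ ↔ ∃ h : g ∈ G, θ ⟨g, h⟩ = ⟨g, h⟩ := by
  constructor
  · rintro ⟨g, hg, rfl⟩
    exact ⟨g.2, hg⟩
  · rintro ⟨h, hg⟩
    exact ⟨⟨g, h⟩, hg, rfl⟩

/-- The Lie algebra of the stabilizer is the fixed space of the involution. -/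
theorem infAction_eq_zero_iff (hG : IsZariskiClosed G) {ρ : G →* GL (Fin n) ℂ}
    {D : Matrix (Fin N) (Fin N) ℂ →ₗ[ℂ] Matrix (Fin n) (Fin n) ℂ} (hD : IsDifferential ρ D)
    {x : Fin n → ℂ} {θ : G →* G} {T : Matrix (Fin N) (Fin N) ℂ →ₗ[ℂ] Matrix (Fin N) (Fin N) ℂ}
    (hT : IsDifferential (G.subtype.comp θ) T) {H₀ : Subgroup (GL (Fin N) ℂ)}
    (hH : H₀ ≤ stabilizer ρ x) (hfin : H₀.relIndex (stabilizer ρ x) ≠ 0)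
    (hθ₁ : identityComponent (fixedSubgroup θ) ⊆ H₀) (hθ₂ : H₀ ≤ fixedSubgroup θ)
    {A : Matrix (Fin N) (Fin N) ℂ} (hA : A ∈ lieAlg G) : infAction D x A = 0 ↔ T A = A := by
  constructor
  · intro h
    have hstab : ∀ t : ℂ, expGL (t • A) ∈ stabilizer ρ x := fun t => by
      refine mem_stabilizer_iff.2 ⟨expGL_mem hG hA t, ?_⟩
      rw [hD.map_exp hA]
      exact vecMul_exp_of_vecMul_eq_zero h t
    -- The factorial of the index is an exponent valid for all `t` at once. Dividing `t` by it then
    -- puts the whole one-parameter group into `H₀`.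
    obtain ⟨m, hm0, hm⟩ : ∃ m : ℕ, m ≠ 0 ∧ ∀ t : ℂ, expGL (m • (t • A)) ∈ H₀ := by
      refine ⟨(H₀.relIndex (stabilizer ρ x)).factorial, Nat.factorial_ne_zero _, fun t => ?_⟩
      obtain ⟨k, hk0, hk, hkm⟩ := Subgroup.exists_pow_mem_of_relIndex_ne_zero hfin (hstab t)
      obtain ⟨l, hl⟩ := Nat.dvd_factorial hk0 hk
      rw [hl, expGL_nsmul, pow_mul]
      exact H₀.pow_mem hkm.1 l
    refine eq_of_forall_exp_smul_eq fun t => ?_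
    have h1 := hm ((m : ℂ)⁻¹ * t)
    have h2 : m • (((m : ℂ)⁻¹ * t) • A) = t • A := by
      rw [← Nat.cast_smul_eq_nsmul ℂ, smul_smul, mul_inv_cancel_left₀ (Nat.cast_ne_zero.2 hm0)]
    rw [h2] at h1
    obtain ⟨h3, h4⟩ := mem_fixedSubgroup_iff.1 (hθ₂ h1)
    have h5 := hT.map_exp hA h3
    rw [MonoidHom.comp_apply, h4] at h5
    exact (congrArg Units.val h5).symm
  · intro h
    refine vecMul_eq_zero_of_vecMul_exp fun t => ?_
    have hfix : ∀ t : ℂ, expGL (t • A) ∈ fixedSubgroup θ := fun t => by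
      refine mem_fixedSubgroup_iff.2 ⟨expGL_mem hG hA t, Subtype.ext ?_⟩
      have := hT.map_exp hA (expGL_mem hG hA t)
      rw [h] at this
      exact this
    -- The one-parameter group is connected and passes through `1`, so it lies in the identity
    -- component of the fixed group, hence in the stabilizer.
    have hpre : @IsPreconnected _ (glZariski N) (Set.range fun t : ℂ => expGL (t • A)) :=
      @isPreconnected_range _ _ _ (glZariski N) _ _
        (continuous_glZariski (Units.continuous_val.comp (continuous_expGL_smul A)))
    have hone : (1 : GL (Fin N) ℂ) ∈ Set.range fun t : ℂ => expGL (t • A) :=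
      ⟨0, by simp [expGL_zero]⟩
    have hcomp : expGL (t • A) ∈ identityComponent (fixedSubgroup θ) := by
      have hsub := @IsPreconnected.subset_connectedComponentIn _ (glZariski N) _ _
        (fixedSubgroup θ : Set (GL (Fin N) ℂ)) hpre hone (by rintro _ ⟨s, rfl⟩; exact hfix s)
      exact hsub ⟨t, rfl⟩
    obtain ⟨h1, h2⟩ := mem_stabilizer_iff.1 (hH (hθ₁ hcomp))
    rwa [hD.map_exp hA] at h2

end Stabilizer

/-! ### The relative invariant -/

section RelativeInvariant

variable {N n : ℕ} {G : Subgroup (GL (Fin N) ℂ)}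

/-- The form `tr(AB) + tr(θA θB)` as a bilinear form on the Lie algebra. -/
def lieForm (G : Subgroup (GL (Fin N) ℂ))
    (T : Matrix (Fin N) (Fin N) ℂ →ₗ[ℂ] Matrix (Fin N) (Fin N) ℂ) :
    LinearMap.BilinForm ℂ (lieAlg G) :=
  LinearMap.mk₂ ℂ (fun A B => sumTraceForm T A B)
    (fun A A' B => by simp [sumTraceForm, add_mul]; ring)
    (fun c A B => by simp [sumTraceForm]; ring)
    (fun A B B' => by simp [sumTraceForm, mul_add]; ring)
    (fun c A B => by simp [sumTraceForm]; ring)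

theorem lieForm_apply (T : Matrix (Fin N) (Fin N) ℂ →ₗ[ℂ] Matrix (Fin N) (Fin N) ℂ)
    (A B : lieAlg G) : lieForm G T A B = sumTraceForm T A B := rfl

theorem sumTraceForm_comm (T : Matrix (Fin N) (Fin N) ℂ →ₗ[ℂ] Matrix (Fin N) (Fin N) ℂ)
    (A B : Matrix (Fin N) (Fin N) ℂ) : sumTraceForm T A B = sumTraceForm T B A := by
  rw [sumTraceForm, sumTraceForm, Matrix.trace_mul_comm, Matrix.trace_mul_comm (T A)]

/-- The adjoint action on the Lie algebra. -/
def adjointAction (hG : IsZariskiClosed G) (g : G) : lieAlg G →ₗ[ℂ] lieAlg G where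
  toFun A := ⟨g.val.val * A * g.val⁻¹.val, conj_mem_lieAlg hG A.2 g.2⟩
  map_add' A B := Subtype.ext (by simp [mul_add, add_mul])
  map_smul' c A := Subtype.ext (by simp)

/-- The chain `x ρ(g) dρ(A) = x dρ(gAg⁻¹) ρ(g)` moves `ρ(g)` to the right. -/
theorem infAction_vecMul (hG : IsZariskiClosed G) {ρ : G →* GL (Fin n) ℂ}
    {D : Matrix (Fin N) (Fin N) ℂ →ₗ[ℂ] Matrix (Fin n) (Fin n) ℂ} (hD : IsDifferential ρ D)
    (x : Fin n → ℂ) (g : G) (A : lieAlg G) :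
    infAction D (Matrix.vecMul x (ρ g).val) A
      = Matrix.vecMul (infAction D x (adjointAction hG g A)) (ρ g).val := by
  have h : D (adjointAction hG g A) = (ρ g).val * D A * (ρ g)⁻¹.val := hD.conj hG A.2 g
  rw [infAction_apply, infAction_apply, h, Matrix.vecMul_vecMul, Matrix.vecMul_vecMul, mul_assoc,
    Units.inv_mul, mul_one]

variable {r : ℕ} (e : Module.Basis (Fin r) ℂ (lieAlg G))
  (D : Matrix (Fin N) (Fin N) ℂ →ₗ[ℂ] Matrix (Fin n) (Fin n) ℂ)

/-- The matrix of the infinitesimal action at `x` in a basis of the Lie algebra. -/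
def actionMatrix (x : Fin n → ℂ) : Matrix (Fin r) (Fin n) ℂ :=
  Matrix.of fun i => infAction D x (e i)

theorem vecMul_actionMatrix (x : Fin n → ℂ) (v : Fin r → ℂ) :
    Matrix.vecMul v (actionMatrix e D x)
      = infAction D x (e.equivFun.symm v : lieAlg G) := by
  rw [Module.Basis.equivFun_symm_apply, Submodule.coe_sum, map_sum]
  funext j
  simp [Matrix.vecMul, dotProduct, actionMatrix]

theorem actionMatrix_vecMul (hG : IsZariskiClosed G) {ρ : G →* GL (Fin n) ℂ}
    (hD : IsDifferential ρ D) (x : Fin n → ℂ) (g : G) :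
    actionMatrix e D (Matrix.vecMul x (ρ g).val)
      = (LinearMap.toMatrix e e (adjointAction hG g)).transpose * actionMatrix e D x
        * (ρ g).val := by
  ext i j
  have h1 : actionMatrix e D (Matrix.vecMul x (ρ g).val) i
      = Matrix.vecMul (infAction D x (adjointAction hG g (e i))) (ρ g).val :=
    infAction_vecMul hG hD x g (e i)
  have h2 : e.equivFun.symm ((LinearMap.toMatrix e e (adjointAction hG g)).transpose i)
      = adjointAction hG g (e i) := by
    rw [LinearEquiv.symm_apply_eq]
    funext k
    simp [LinearMap.toMatrix_apply]
  rw [h1, ← h2, ← vecMul_actionMatrix]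
  rfl

/-- The symmetric matrix of quadratic forms on `X` attached to an invariant form on the Lie
algebra. -/
def momentMatrix (b : Matrix (Fin r) (Fin r) ℂ) (x : Fin n → ℂ) : Matrix (Fin n) (Fin n) ℂ :=
  (actionMatrix e D x).transpose * b⁻¹ * actionMatrix e D x

/-- If `m` preserves `b`, then `m b⁻¹ mᵀ = b⁻¹`. The adjoint factors therefore cancel and the moment
matrix changes by the congruence `ρ(g)ᵀ · ρ(g)`, which contributes the square of the determinant. -/
theorem det_momentMatrix_vecMul (hG : IsZariskiClosed G) {ρ : G →* GL (Fin n) ℂ}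
    (hD : IsDifferential ρ D) {b : Matrix (Fin r) (Fin r) ℂ} (hb : b.det ≠ 0) {g : G}
    (hbg : (LinearMap.toMatrix e e (adjointAction hG g)).transpose * b
      * LinearMap.toMatrix e e (adjointAction hG g) = b) (x : Fin n → ℂ) :
    (momentMatrix e D b (Matrix.vecMul x (ρ g).val)).det
      = (ρ g).val.det ^ 2 * (momentMatrix e D b x).det := by
  set m := LinearMap.toMatrix e e (adjointAction hG g)
  have hu : IsUnit b.det := isUnit_iff_ne_zero.2 hb
  have h1 : (b⁻¹ * m.transpose * b) * m = 1 := by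
    rw [mul_assoc, mul_assoc, ← mul_assoc m.transpose, hbg, Matrix.nonsing_inv_mul _ hu]
  have h2 : m * (b⁻¹ * m.transpose * b) = 1 := mul_eq_one_comm.1 h1
  have h3 : m * b⁻¹ * m.transpose = b⁻¹ := by
    calc m * b⁻¹ * m.transpose = m * (b⁻¹ * m.transpose * b) * b⁻¹ := by
          simp only [mul_assoc]; rw [Matrix.mul_nonsing_inv _ hu, mul_one]
      _ = b⁻¹ := by rw [h2, one_mul]
  have h4 : momentMatrix e D b (Matrix.vecMul x (ρ g).val)
      = (ρ g).val.transpose * momentMatrix e D b x * (ρ g).val := by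
    rw [momentMatrix, actionMatrix_vecMul e D hG hD, Matrix.transpose_mul, Matrix.transpose_mul,
      Matrix.transpose_transpose, momentMatrix]
    calc _ = (ρ g).val.transpose * ((actionMatrix e D x).transpose * (m * b⁻¹ * m.transpose)
            * actionMatrix e D x) * (ρ g).val := by simp only [Matrix.mul_assoc]; rfl
      _ = _ := by rw [h3]
  rw [h4, Matrix.det_mul, Matrix.det_mul, Matrix.det_transpose]
  ring

/-- The determinant of the moment matrix is a polynomial. -/
theorem exists_eval_eq_det_momentMatrix (b : Matrix (Fin r) (Fin r) ℂ) :
    ∃ φ : MvPolynomial (Fin n) ℂ, ∀ x, MvPolynomial.eval x φ = (momentMatrix e D b x).det := by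
  let Λ : Matrix (Fin r) (Fin n) (MvPolynomial (Fin n) ℂ) :=
    Matrix.of fun i j => ∑ k, MvPolynomial.X k * MvPolynomial.C (D (e i) k j)
  let β : Matrix (Fin r) (Fin r) (MvPolynomial (Fin n) ℂ) := b⁻¹.map MvPolynomial.C
  refine ⟨(Λ.transpose * β * Λ).det, fun x => ?_⟩
  have h1 : Λ.map (MvPolynomial.eval x) = actionMatrix e D x := by
    ext i j
    simp [Λ, actionMatrix, infAction_apply, Matrix.vecMul, dotProduct]
  have h2 : β.map (MvPolynomial.eval x) = b⁻¹ := by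
    ext i j
    simp [β]
  rw [RingHom.map_det, RingHom.mapMatrix_apply, Matrix.map_mul, Matrix.map_mul, h2,
    Matrix.transpose_map, h1]
  rfl

/-- The complex form of the existence of the relative invariant. -/
theorem exists_complex_relativeInvariant (hG : IsZariskiClosed G) (hred : IsReductive G)
    {ρ : G →* GL (Fin n) ℂ} (hρ : IsRealMorphism ρ) (hsymm : IsEssentiallySymmetric ρ) :
    ∃ φ : MvPolynomial (Fin n) ℂ, φ ≠ 0 ∧ ∀ (g : G) (x : Fin n → ℂ),
      MvPolynomial.eval (Matrix.vecMul x (ρ g).val) φ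
        = (ρ g).val.det ^ 2 * MvPolynomial.eval x φ := by
  obtain ⟨x₀, hx₀, H₀, -, hH, hfin, θ, ⟨hθ, hθθ⟩, hθ₁, hθ₂⟩ := hsymm
  obtain ⟨D, hD⟩ := exists_isDifferential hG hρ
  obtain ⟨T, hT⟩ := exists_isDifferential hG hθ
  set x := toComplex x₀
  have hker := fun {A} (hA : A ∈ lieAlg G) =>
    infAction_eq_zero_iff hG hD hT hH hfin hθ₁ hθ₂ hA
  have hsurj := map_infAction_eq_top hG hD (isOpen_of_affineZariski hx₀.1)
  have hnd := fun {A} (hA : A ∈ lieAlg G) => sumTraceForm_nondegenerate hG hred hθ hT hA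
  let e := Module.finBasis ℂ (lieAlg G)
  let b := LinearMap.BilinForm.toMatrix e (lieForm G T)
  have hbv : ∀ (v : Fin _ → ℂ) (B : lieAlg G),
      dotProduct (e.equivFun B) (b.mulVec v) = sumTraceForm T B (e.equivFun.symm v : lieAlg G) := by
    intro v B
    rw [← lieForm_apply, LinearMap.BilinForm.apply_eq_dotProduct_toMatrix_mulVec e]
    congr 2
    exact (e.equivFun.apply_symm_apply v).symm
  have hb : b.det ≠ 0 := by
    intro h0
    obtain ⟨v, hv, hbv0⟩ := Matrix.exists_mulVec_eq_zero_iff.2 h0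
    have h1 : (e.equivFun.symm v : lieAlg G) = 0 := by
      refine Subtype.ext (hnd (e.equivFun.symm v).2 fun B hB => ?_)
      rw [sumTraceForm_comm, ← hbv v ⟨B, hB⟩, hbv0, dotProduct_zero]
    exact hv ((LinearEquiv.map_eq_zero_iff _).1 h1)
  obtain ⟨φ, hφ⟩ := exists_eval_eq_det_momentMatrix e D b
  refine ⟨φ, ?_, fun g y => ?_⟩
  · rintro rfl
    have h0 := hφ x
    rw [map_zero] at h0
    obtain ⟨ξ, hξ, hξ0⟩ := Matrix.exists_mulVec_eq_zero_iff.2 h0.symm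
    -- `A` represents the functional `B ↦ ⟨x dρ(B), ξ⟩` with respect to the form. Degeneracy of the
    -- moment matrix at `ξ` says exactly that `A` annihilates `x`.
    let v := b⁻¹.mulVec ((actionMatrix e D x).mulVec ξ)
    let A : lieAlg G := e.equivFun.symm v
    have hA : infAction D x A = 0 := by
      rw [← vecMul_actionMatrix, ← Matrix.mulVec_transpose, ← hξ0, momentMatrix]
      simp only [v, Matrix.mulVec_mulVec, Matrix.mul_assoc]
    have hAB : ∀ B : lieAlg G, sumTraceForm T B A = dotProduct (infAction D x B) ξ := by
      intro B
      rw [← hbv v B]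
      simp only [v]
      rw [Matrix.mulVec_mulVec, Matrix.mul_nonsing_inv _ (isUnit_iff_ne_zero.2 hb),
        Matrix.one_mulVec, Matrix.dotProduct_mulVec, vecMul_actionMatrix,
        LinearEquiv.symm_apply_apply]
    have hTA : T A = A := (hker A.2).1 hA
    have hA0 : (A : Matrix (Fin N) (Fin N) ℂ) = 0 := by
      refine hnd A.2 fun B hB => ?_
      have hTB := hT.mem_lieAlg hG hB
      have hTT := hT.comp_self hG hθθ hB
      -- `B + T B` is fixed by the involution, so it annihilates `x` and pairs to zero with `A`. As
      -- `T A = A`, this pairing is twice that of `B` with `A`.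
      have h1 : sumTraceForm T (B + T B) A = 0 := by
        have h2 := hAB ⟨B + T B, add_mem hB hTB⟩
        rw [h2, (hker (add_mem hB hTB)).2 (by rw [map_add, hTT, add_comm]), zero_dotProduct]
      rw [sumTraceForm_comm]
      simp only [sumTraceForm, map_add, hTA, hTT, add_mul, Matrix.trace_add] at h1 ⊢
      linear_combination h1 / 2
    have hξ' : ∀ y : Fin n → ℂ, dotProduct y ξ = 0 := by
      intro y
      have hy : y ∈ (lieAlg G).map (infAction D x) := by rw [hsurj]; trivial
      obtain ⟨B, hB, rfl⟩ := hy
      rw [← hAB ⟨B, hB⟩, hA0, sumTraceForm]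
      simp
    exact hξ (funext fun i => by simpa using hξ' (Pi.single i 1))
  · rw [hφ, hφ]
    refine det_momentMatrix_vecMul e D hG hD hb ?_ y
    have h1 : (lieForm G T).comp (adjointAction hG g) (adjointAction hG g) = lieForm G T := by
      ext A B
      exact sumTraceForm_conj hG hT A.2 B.2 g
    conv_rhs => rw [show b = LinearMap.BilinForm.toMatrix e
      ((lieForm G T).comp (adjointAction hG g) (adjointAction hG g)) by rw [h1]]
    rw [LinearMap.BilinForm.toMatrix_comp e e]

end RelativeInvariant

end

end PVS

namespace PVS

noncomputable section

/-! ### Real relative invariants -/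

section Real

variable {N n : ℕ} {G : Subgroup (GL (Fin N) ℂ)}

theorem exists_re_im {σ : Type*} (φ : MvPolynomial σ ℂ) :
    ∃ p q : MvPolynomial σ ℝ, ∀ x : σ → ℂ,
      MvPolynomial.eval x φ = MvPolynomial.aeval x p + Complex.I * MvPolynomial.aeval x q := by
  induction φ using MvPolynomial.induction_on with
  | C a =>
    refine ⟨MvPolynomial.C a.re, MvPolynomial.C a.im, fun x => ?_⟩
    simp only [MvPolynomial.eval_C, MvPolynomial.aeval_C, Complex.coe_algebraMap]
    rw [mul_comm]
    exact (Complex.re_add_im a).symm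
  | add φ ψ hφ hψ =>
    obtain ⟨p, q, h⟩ := hφ
    obtain ⟨p', q', h'⟩ := hψ
    exact ⟨p + p', q + q', fun x => by rw [map_add, h, h', map_add, map_add]; ring⟩
  | mul_X φ i hφ =>
    obtain ⟨p, q, h⟩ := hφ
    exact ⟨p * MvPolynomial.X i, q * MvPolynomial.X i, fun x => by
      rw [map_mul, h, map_mul, map_mul, MvPolynomial.eval_X, MvPolynomial.aeval_X]; ring⟩

theorem conj_aeval {σ : Type*} (p : MvPolynomial σ ℝ) (x : σ → ℂ) :
    (starRingEnd ℂ) (MvPolynomial.aeval x p)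
      = MvPolynomial.aeval (fun i => (starRingEnd ℂ) (x i)) p :=
  MvPolynomial.comp_aeval_apply x (Complex.conjAe : ℂ →ₐ[ℝ] ℂ) p

/-- Complex conjugation of an invertible matrix. -/
def conjGL (g : GL (Fin N) ℂ) : GL (Fin N) ℂ :=
  Matrix.GeneralLinearGroup.map (starRingEnd ℂ) g

theorem conjGL_mem (hG : IsRealAlgebraic G) {g : GL (Fin N) ℂ} (hg : g ∈ G) : conjGL g ∈ G := by
  obtain ⟨I, hI⟩ := hG
  rw [hI, MvPolynomial.mem_zeroLocus_iff] at hg ⊢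
  intro p hp
  have h := conj_aeval p (entries g)
  rw [hg p hp, map_zero] at h
  exact h.symm

theorem IsRealMorphism.map_conj {ρ : G →* GL (Fin n) ℂ} (hρ : IsRealMorphism ρ) (g : G)
    (hg : conjGL g.val ∈ G) : (ρ ⟨conjGL g.val, hg⟩).val = (ρ g).val.map (starRingEnd ℂ) := by
  ext i j
  obtain ⟨p, k, hp⟩ := hρ i j
  have h1 := hp ⟨conjGL g.val, hg⟩
  have h2 := hp g
  simp only at h1 h2
  have h3 : (conjGL g.val).val.det = (starRingEnd ℂ) g.val.val.det :=
    (RingHom.map_det (starRingEnd ℂ) g.val.val).symm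
  rw [h1, Matrix.map_apply, h2, map_mul, map_pow, map_inv₀, conj_aeval, h3]
  rfl

theorem isRealRegular_detSq {ρ : G →* GL (Fin n) ℂ} (hρ : IsRealMorphism ρ) :
    IsRealRegular G (fun g => (detSq ρ g : ℂ)) := by
  have h : (fun g : G => (ρ g).val.det) ∈ regularFunctions ℝ G :=
    det_mem_regularFunctions ℝ G hρ
  exact Subalgebra.pow_mem _ h 2

theorem coe_detSq (ρ : G →* GL (Fin n) ℂ) (g : G) : (detSq ρ g : ℂ) = (ρ g).val.det ^ 2 := rfl

/-- `G` and `ρ` are defined over `ℝ`, so the polynomial with conjugated coefficients is equivariant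
with the same character. Hence both the real part `p` and the imaginary part `q` are equivariant,
and at least one of them is nonzero. -/
theorem exists_relativeInvariant (hG : IsRealAlgebraic G) (hred : IsReductive G)
    {ρ : G →* GL (Fin n) ℂ} (hρ : IsRealMorphism ρ) (hsymm : IsEssentiallySymmetric ρ) :
    ∃ φ : MvPolynomial (Fin n) ℝ, IsRelativeInvariant ρ φ (detSq ρ) := by
  obtain ⟨φ, hφ0, hφ⟩ := exists_complex_relativeInvariant hG.isZariskiClosed hred hρ hsymm
  obtain ⟨p, q, hpq⟩ := exists_re_im φ
  let c : (Fin n → ℂ) → (Fin n → ℂ) := fun x i => (starRingEnd ℂ) (x i)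
  have hconj : ∀ x, MvPolynomial.aeval x p - Complex.I * MvPolynomial.aeval x q
      = (starRingEnd ℂ) (MvPolynomial.eval (c x) φ) := by
    intro x
    rw [hpq, map_add, map_mul, conj_aeval, conj_aeval, Complex.conj_I]
    simp only [c, Complex.conj_conj]
    ring
  have hconj' : ∀ (g : G) (x : Fin n → ℂ),
      MvPolynomial.aeval (Matrix.vecMul x (ρ g).val) p
        - Complex.I * MvPolynomial.aeval (Matrix.vecMul x (ρ g).val) q
      = (ρ g).val.det ^ 2 * (MvPolynomial.aeval x p - Complex.I * MvPolynomial.aeval x q) := by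
    intro g x
    have hg := conjGL_mem hG g.2
    have hρg := hρ.map_conj g hg
    have h1 : c (Matrix.vecMul x (ρ g).val) = Matrix.vecMul (c x) (ρ ⟨conjGL g.val, hg⟩).val := by
      rw [hρg]
      funext j
      simp [c, Matrix.vecMul, dotProduct]
    have h2 : (ρ ⟨conjGL g.val, hg⟩).val.det = (starRingEnd ℂ) (ρ g).val.det := by
      rw [hρg]
      exact (RingHom.map_det (starRingEnd ℂ) (ρ g).val).symm
    rw [hconj, hconj, h1, hφ, h2, map_mul, map_pow, Complex.conj_conj]
  have hp : ∀ (g : G) (x : Fin n → ℂ), MvPolynomial.aeval (Matrix.vecMul x (ρ g).val) p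
      = (detSq ρ g : ℂ) * MvPolynomial.aeval x p := by
    intro g x
    have h1 := hφ g x
    have h2 := hconj' g x
    rw [hpq, hpq] at h1
    rw [coe_detSq]
    linear_combination (h1 + h2) / 2
  have hq : ∀ (g : G) (x : Fin n → ℂ), MvPolynomial.aeval (Matrix.vecMul x (ρ g).val) q
      = (detSq ρ g : ℂ) * MvPolynomial.aeval x q := by
    intro g x
    have h1 := hφ g x
    have h2 := hconj' g x
    rw [hpq, hpq] at h1
    rw [coe_detSq]
    refine mul_left_cancel₀ Complex.I_ne_zero ?_
    linear_combination (h1 - h2) / 2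
  by_cases hp0 : p = 0
  · refine ⟨q, ?_, isRealRegular_detSq hρ, hq⟩
    rintro rfl
    exact hφ0 (MvPolynomial.funext fun x => by rw [hpq, hp0]; simp)
  · exact ⟨p, hp0, isRealRegular_detSq hρ, hp⟩

end Real

/-! ### Densities -/

section Densities

variable {N n : ℕ} {G : Subgroup (GL (Fin N) ℂ)} {ρ : G →* GL (Fin n) ℂ}

theorem aeval_toComplex (φ : MvPolynomial (Fin n) ℝ) (x : Fin n → ℝ) :
    MvPolynomial.aeval (toComplex x) φ = (MvPolynomial.eval x φ : ℂ) := by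
  rw [show (MvPolynomial.eval x φ) = MvPolynomial.aeval x φ from rfl]
  exact MvPolynomial.aeval_algebraMap_apply ℂ x φ

/-- Equivariance spreads a zero over the whole complex orbit, whose Zariski density would make `φ`
the zero polynomial. -/
theorem IsRelativeInvariant.eval_ne_zero {φ : MvPolynomial (Fin n) ℝ} {χ : G →* ℂˣ}
    (hφ : IsRelativeInvariant ρ φ χ) {x : Fin n → ℝ} (hx : x ∈ realOpenOrbit ρ) :
    MvPolynomial.eval x φ ≠ 0 := by
  intro h0
  have h1 : φ.map (algebraMap ℝ ℂ) = 0 := by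
    refine eval_eq_zero_of_dense hx.2 ?_
    rintro _ ⟨g, rfl⟩
    have h2 := hφ.2.2 g (toComplex x)
    rw [aeval_toComplex, h0, Complex.ofReal_zero, mul_zero] at h2
    rw [MvPolynomial.eval_map]
    exact h2
  exact hφ.1 (MvPolynomial.map_injective _ (algebraMap ℝ ℂ).injective (by rw [h1, map_zero]))

/-- The real matrix of the action of a real point. -/
def realMatrix (ρ : G →* GL (Fin n) ℂ) (g : realPoints G) : Matrix (Fin n) (Fin n) ℝ :=
  (ρ (realToComplex g)).val.map Complex.re

theorem ofReal_det_realMatrix (hρ : IsRealMorphism ρ) (g : realPoints G) :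
    ((realMatrix ρ g).det : ℂ) = (ρ (realToComplex g)).val.det := by
  have h : (ρ (realToComplex g)).val = (realMatrix ρ g).map (algebraMap ℝ ℂ) := by
    ext i j
    exact (ofReal_re_rep hρ g i j).symm
  rw [h]
  exact RingHom.map_det (algebraMap ℝ ℂ) _

theorem det_realMatrix_ne_zero (hρ : IsRealMorphism ρ) (g : realPoints G) :
    (realMatrix ρ g).det ≠ 0 := by
  rw [← Complex.ofReal_ne_zero, ofReal_det_realMatrix hρ]
  exact (Matrix.GeneralLinearGroup.det (ρ (realToComplex g))).ne_zero

theorem IsRelativeInvariant.eval_realAct (hρ : IsRealMorphism ρ) {φ : MvPolynomial (Fin n) ℝ}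
    (hφ : IsRelativeInvariant ρ φ (detSq ρ)) (g : realPoints G) (x : Fin n → ℝ) :
    MvPolynomial.eval (realAct ρ g x) φ = (realMatrix ρ g).det ^ 2 * MvPolynomial.eval x φ := by
  have h := hφ.2.2 (realToComplex g) (toComplex x)
  rw [← toComplex_realAct hρ, aeval_toComplex, aeval_toComplex, coe_detSq,
    ← ofReal_det_realMatrix hρ] at h
  exact_mod_cast h

/-- The action is linear, hence equal to its own derivative, and densities scale by a power of its
determinant. The transpose appears because the action is on row vectors. -/
theorem pullbackAt_eq_smul {s : ℝ} (g : realPoints G) (x : Fin n → ℝ) (δ : Density n s) :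
    pullbackAt ρ g x δ = ((|(realMatrix ρ g).det| ^ s : ℝ) : ℂ) • δ := by
  let L : (Fin n → ℝ) →ₗ[ℝ] (Fin n → ℝ) := Matrix.toLin' (realMatrix ρ g).transpose
  have h1 : realAct ρ g = L.toContinuousLinearMap := by
    funext x
    simp only [L, LinearMap.coe_toContinuousLinearMap', Matrix.toLin'_apply,
      Matrix.mulVec_transpose]
    rfl
  have h2 : fderiv ℝ (realAct ρ g) x = L.toContinuousLinearMap := by
    rw [h1]; exact ContinuousLinearMap.fderiv _
  have h3 : LinearMap.det L = (realMatrix ρ g).det := by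
    rw [LinearMap.det_toLin', Matrix.det_transpose]
  apply Subtype.ext
  funext v
  rw [pullbackAt, h2, ← h3]
  exact δ.2 L v

theorem contDiffOn_abs_eval_rpow {φ : MvPolynomial (Fin n) ℝ} {U : Set (Fin n → ℝ)}
    (hφ : ∀ x ∈ U, MvPolynomial.eval x φ ≠ 0) (a : ℝ) :
    ContDiffOn ℝ ∞ (fun x => ((|MvPolynomial.eval x φ| ^ a : ℝ) : ℂ)) U := by
  intro x hx
  have h1 : ContDiffAt ℝ ∞ (fun x : Fin n → ℝ => MvPolynomial.eval x φ) x :=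
    (AnalyticOnNhd.eval_mvPolynomial φ x trivial).contDiffAt
  have h2 : ContDiffAt ℝ ∞ (fun x => |MvPolynomial.eval x φ| ^ a) x :=
    (h1.abs (hφ x hx)).rpow_const_of_ne (abs_ne_zero.2 (hφ x hx))
  exact (Complex.ofRealCLM.contDiff.contDiffAt.comp x h2).contDiffWithinAt

theorem alternatingMap_apply_basis_ne_zero {Ω : (Fin n → ℝ) [⋀^Fin n]→ₗ[ℝ] ℝ} (hΩ : Ω ≠ 0) :
    Ω (Pi.basisFun ℝ (Fin n)) ≠ 0 := by
  intro h
  apply hΩ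
  rw [Ω.eq_smul_basis_det (Pi.basisFun ℝ (Fin n)), h, zero_smul]

/-- The value of a density on the standard basis identifies the line of densities with `ℂ`. -/
def densityEquiv (n : ℕ) (s : ℝ) : Density n s ≃ₗ[ℂ] ℂ where
  toFun δ := δ.val (Pi.basisFun ℝ (Fin n))
  map_add' _ _ := rfl
  map_smul' _ _ := rfl
  invFun c := c • absPow (Pi.basisFun ℝ (Fin n)).det s
  left_inv δ := by
    apply Subtype.ext
    funext v
    let T := (Pi.basisFun ℝ (Fin n)).constr ℝ v
    have hT : ∀ i, T (Pi.basisFun ℝ (Fin n) i) = v i := fun i => Module.Basis.constr_basis _ _ _ _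
    have h1 := δ.2 T (Pi.basisFun ℝ (Fin n))
    have h2 := alternating_comp (Pi.basisFun ℝ (Fin n)).det T (Pi.basisFun ℝ (Fin n))
    simp only [hT] at h1 h2
    rw [Module.Basis.det_self, mul_one] at h2
    rw [h1, ← h2, mul_comm]
    rfl
  right_inv c := by
    change c * ((|(Pi.basisFun ℝ (Fin n)).det (Pi.basisFun ℝ (Fin n))| ^ s : ℝ) : ℂ) = c
    rw [Module.Basis.det_self]
    simp

/-- The trivialization is evaluation on the standard basis times `|φ|^(s/2)`. Since `φ(xg) = det²
φ(x)`, this weight absorbs the factor `|det|^s` acquired by a density. -/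
theorem isEquivariantlyTrivializable_of_isRelativeInvariant (hρ : IsRealMorphism ρ)
    {φ : MvPolynomial (Fin n) ℝ} (hφ : IsRelativeInvariant ρ φ (detSq ρ)) (s : ℝ) :
    IsEquivariantlyTrivializable ρ s := by
  classical
  -- The value `1` on the zero locus of `φ` only serves to make the fibre maps invertible
  -- everywhere; that locus does not meet `X⁺(ℝ)`.
  let w : (Fin n → ℝ) → ℂ := fun x =>
    if MvPolynomial.eval x φ = 0 then 1 else ((|MvPolynomial.eval x φ| ^ (s / 2) : ℝ) : ℂ)
  have hpos : ∀ {x}, MvPolynomial.eval x φ ≠ 0 → |MvPolynomial.eval x φ| ^ (s / 2) ≠ 0 :=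
    fun h => (Real.rpow_pos_of_pos (abs_pos.2 h) _).ne'
  have hwφ : ∀ {x}, MvPolynomial.eval x φ ≠ 0 →
      w x = ((|MvPolynomial.eval x φ| ^ (s / 2) : ℝ) : ℂ) := fun h => if_neg h
  have hw : ∀ x, w x ≠ 0 := by
    intro x
    by_cases h : MvPolynomial.eval x φ = 0
    · simp [w, h]
    · rw [hwφ h]; exact_mod_cast hpos h
  have hne : ∀ x ∈ realOpenOrbit ρ, MvPolynomial.eval x φ ≠ 0 := fun x hx => hφ.eval_ne_zero hx
  have hsm : ContDiffOn ℝ ∞ w (realOpenOrbit ρ) :=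
    (contDiffOn_abs_eval_rpow hne (s / 2)).congr fun x hx => hwφ (hne x hx)
  refine ⟨fun x => (densityEquiv n s).trans (LinearEquiv.smulOfNeZero ℂ ℂ (w x) (hw x)),
    fun σ hσ => hsm.mul (hσ _), fun f hf v => ?_, fun g x hx δ => ?_⟩
  · have h : (fun x => (((densityEquiv n s).trans
        (LinearEquiv.smulOfNeZero ℂ ℂ (w x) (hw x))).symm (f x)).val v)
        = fun x => (w x)⁻¹ * f x * (absPow (Pi.basisFun ℝ (Fin n)).det s).val v := by
      funext x
      rfl
    rw [h]
    exact ((hsm.inv fun x _ => hw x).mul hf).mul contDiffOn_const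
  · have h1 := hφ.eval_realAct hρ g x
    have hd := det_realMatrix_ne_zero hρ g
    have h2 : MvPolynomial.eval (realAct ρ g x) φ ≠ 0 := by
      rw [h1]; exact mul_ne_zero (pow_ne_zero 2 hd) (hne x hx)
    have h3 : |MvPolynomial.eval (realAct ρ g x) φ| ^ (s / 2)
        = |(realMatrix ρ g).det| ^ s * |MvPolynomial.eval x φ| ^ (s / 2) := by
      rw [h1, abs_mul, abs_pow, Real.mul_rpow (by positivity) (abs_nonneg _),
        ← Real.rpow_natCast, ← Real.rpow_mul (abs_nonneg _)]
      congr 2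
      push_cast
      ring
    rw [pullbackAt_eq_smul]
    change w x * (((|(realMatrix ρ g).det| ^ s : ℝ) : ℂ) * δ.val _) = w (realAct ρ g x) * δ.val _
    rw [hwφ h2, hwφ (hne x hx), h3]
    push_cast
    ring

theorem isSmoothSection_twistedSection {φ : MvPolynomial (Fin n) ℝ} {U : Set (Fin n → ℝ)}
    (hφ : ∀ x ∈ U, MvPolynomial.eval x φ ≠ 0) (a : ℝ) (Ω : (Fin n → ℝ) [⋀^Fin n]→ₗ[ℝ] ℝ)
    (s : ℝ) : IsSmoothSection U (twistedSection φ a Ω s) :=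
  fun _ => (contDiffOn_abs_eval_rpow hφ a).mul contDiffOn_const

/-- The total exponent of `|det ρ(g)|` is `s + 2a`. -/
theorem isInvariantSection_twistedSection (hρ : IsRealMorphism ρ) {φ : MvPolynomial (Fin n) ℝ}
    (hφ : IsRelativeInvariant ρ φ (detSq ρ)) (Ω : (Fin n → ℝ) [⋀^Fin n]→ₗ[ℝ] ℝ) {a s : ℝ}
    (has : s + 2 * a = 0) : IsInvariantSection ρ (twistedSection φ a Ω s) := by
  intro g x _
  have hd := abs_pos.2 (det_realMatrix_ne_zero hρ g)
  have h : |(realMatrix ρ g).det| ^ s * |MvPolynomial.eval (realAct ρ g x) φ| ^ a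
      = |MvPolynomial.eval x φ| ^ a := by
    rw [hφ.eval_realAct hρ, abs_mul, abs_pow, Real.mul_rpow (by positivity) (abs_nonneg _),
      ← Real.rpow_natCast, ← Real.rpow_mul hd.le, ← mul_assoc, ← Real.rpow_add hd]
    push_cast
    rw [has, Real.rpow_zero, one_mul]
  rw [pullbackAt_eq_smul, twistedSection, smul_smul, ← Complex.ofReal_mul, h]
  rfl

theorem twistedSection_ne_zero {φ : MvPolynomial (Fin n) ℝ} {x : Fin n → ℝ}
    (hx : MvPolynomial.eval x φ ≠ 0) {Ω : (Fin n → ℝ) [⋀^Fin n]→ₗ[ℝ] ℝ} (hΩ : Ω ≠ 0) (a s : ℝ) :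
    twistedSection φ a Ω s x ≠ 0 := by
  intro h
  have h1 : ((|MvPolynomial.eval x φ| ^ a : ℝ) : ℂ)
      * ((|Ω (Pi.basisFun ℝ (Fin n))| ^ s : ℝ) : ℂ) = 0 :=
    congrFun (congrArg Subtype.val h) (Pi.basisFun ℝ (Fin n))
  have h2 := Real.rpow_pos_of_pos (abs_pos.2 hx) a
  have h3 := Real.rpow_pos_of_pos (abs_pos.2 (alternatingMap_apply_basis_ne_zero hΩ)) s
  exact (mul_pos h2 h3).ne' (by exact_mod_cast h1)

end Densities

end

end PVS

/-! ### Assembly of the four assertions. -/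

theorem mainTheorem8 {N n : ℕ} (G : Subgroup (GL (Fin N) ℂ)) (hG : IsRealAlgebraic G)
    (hconn : IsConnectedGroup G) (hred : IsReductive G)
    (ρ : G →* GL (Fin n) ℂ) (hρ : IsRealMorphism ρ)
    (hX : IsPrehomogeneous ρ) (hsymm : IsEssentiallySymmetric ρ) :
    IsEquivariantlyTrivializable ρ (1 / 2) ∧
    (∃ φ : MvPolynomial (Fin n) ℝ, IsRelativeInvariant ρ φ (detSq ρ)) ∧
    (∀ φ : MvPolynomial (Fin n) ℝ, IsRelativeInvariant ρ φ (detSq ρ) →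
      ∀ Ω : (Fin n → ℝ) [⋀^Fin n]→ₗ[ℝ] ℝ, Ω ≠ 0 →
        IsSmoothSection (realOpenOrbit ρ) (twistedSection φ (-(1 / 4)) Ω (1 / 2)) ∧
        IsInvariantSection ρ (twistedSection φ (-(1 / 4)) Ω (1 / 2)) ∧
        ∀ x ∈ realOpenOrbit ρ,
          MvPolynomial.eval x φ ≠ 0 ∧ twistedSection φ (-(1 / 4)) Ω (1 / 2) x ≠ 0) ∧
    IsEquivariantlyTrivializable ρ 1 := by
  have hex := exists_relativeInvariant hG hred hρ hsymm
  obtain ⟨φ₀, hφ₀⟩ := hex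
  refine ⟨isEquivariantlyTrivializable_of_isRelativeInvariant hρ hφ₀ _, ⟨φ₀, hφ₀⟩,
    fun φ hφ Ω hΩ => ?_, isEquivariantlyTrivializable_of_isRelativeInvariant hρ hφ₀ _⟩
  have hne : ∀ x ∈ realOpenOrbit ρ, MvPolynomial.eval x φ ≠ 0 := fun x hx => hφ.eval_ne_zero hx
  exact ⟨isSmoothSection_twistedSection hne _ _ _,
    isInvariantSection_twistedSection hρ hφ Ω (by norm_num),
    fun x hx => ⟨hne x hx, twistedSection_ne_zero (hne x hx) hΩ _ _⟩⟩
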